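/- **Proposition.** Let $n\ge 1$. For every $\epsilon\in(0,1)$ consider an $n\times n$ input-queued switch with queue lengths $$q_{ij}(t+1)=[q_{ij}(t)+a_{ij}(t)-s_{ij}(t)]^+,\qquad 1\le i,j\le n,\ t=0,1,2,\dots$$ The numbers of arrivals $a_{ij}(t)\in\{0,1,2,\dots\}$ are independent over all $(i,j,t)$, identically distributed in $t$ for each $(i,j)$, and almost surely bounded by a constant; $\mathbb P(a_{ij}(t)=0\ \forall i,j)>0$; and the traffic is uniform, $\mathbb E[a_{ij}(t)]=\frac{1-\epsilon}{n}$ for all $i,j$. All of these laws may depend on $\epsilon$. The scheduling is uniformly random: the schedules $\mathbf s(t)$ are i.i.d., uniformly distributed on the $n\times n$ permutation matrices, and independent of the arrivals. The initial queue lengths $\mathbf q(0)\in\{0,1,2,\dots\}^{n\times n}$ are independent of the arrivals and of the schedules. Then the following holds. 1. For every $\epsilon\in(0,1)$, $\mathbf q(t)$ is a time-homogeneous Markov chain with transition probabilities $\mathbb P([\mathbf x+\mathbf a(0)-\mathbf s(0)]^+=\mathbf y)$. On the set of states reachable from $\mathbf 0$, which is closed and which $\mathbf q(t)$ almost surely enters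 and never leaves again, this chain is irreducible, aperiodic and positive recurrent. 2. For every $\epsilon\in(0,1)$, $\mathbf q(t)$ converges in distribution as $t\to\infty$ to a random matrix $\bar{\mathbf q}$ with $\mathbb E[\sum_{ij}\bar q_{ij}]<\infty$. 3. If $\mathrm{Var}(a_{ij}(t))\to\tilde\sigma_{ij}^2$ as $\epsilon\downarrow0$ for all $i,j$, then, with $\|\tilde{\boldsymbol\sigma}\|^2=\sum_{ij}\tilde\sigma_{ij}^2$, $$\lim_{\epsilon\downarrow0}\epsilon\,\mathbb E\Big[\sum_{ij}\bar q_{ij}\Big]=\frac n2\|\tilde{\boldsymbol\sigma}\|^2+\frac{n(n-1)}2 .$$ If moreover $n\ge2$, random scheduling is not MaxWeight-like, that is, $\epsilon\,\mathbb E[\sum_{ij}\bar q_{ij}]$ does not converge to $\big(1-\frac1{2n}\big)\|\tilde{\boldsymbol\sigma}\|^2$ as $\epsilon\downarrow0$. 4. If the traffic is uniform Bernoulli, i.e. $a_{ij}(t)\in\{0,1\}$ almost surely for all $i,j,t,\epsilon$, then $$\lim_{\epsilon\downarrow0}\epsilon\,\mathbb E\Big[\sum_{ij}\bar q_{ij}\Big]=n(n-1).$$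 -/

import Mathlib

open MeasureTheory ProbabilityTheory Filter Topology
open scoped ENNReal

/-! ### Countable-state Markov chains -/

section MarkovChain

variable {S : Type*} [DecidableEq S]

/-- The `k`-step transition probabilities of the transition matrix `P`. -/
noncomputable def stepProb (P : S → S → ℝ≥0∞) : ℕ → S → S → ℝ≥0∞
  | 0, x, y => if x = y then 1 else 0
  | k + 1, x, y => ∑' z, P x z * stepProb P k z y

/-- `firstPassageProb P k x y` is the probability that the chain started at `x` visits `y` for the
first time after time `0` exactly at time `k`. -/
noncomputable def firstPassageProb (P : S → S → ℝ≥0∞) : ℕ → S → S → ℝ≥0∞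
  | 0, _, _ => 0
  | 1, x, y => P x y
  | k + 2, x, y => ∑' z, if z = y then 0 else P x z * firstPassageProb P (k + 1) z y

/-- The states that can be reached from `x` (in zero or more steps). -/
def reachableFrom (P : S → S → ℝ≥0∞) (x : S) : Set S :=
  {y | ∃ k, 0 < stepProb P k x y}

/-- The state `x` is positive recurrent: the chain started at `x` returns to `x` with
probability one, and the mean return time is finite. -/
def IsPositiveRecurrentState (P : S → S → ℝ≥0∞) (x : S) : Prop :=
  ∑' k, firstPassageProb P k x x = 1 ∧ ∑' k : ℕ, (k : ℝ≥0∞) * firstPassageProb P k x x < ∞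

/-- The state `x` is aperiodic: the only common divisor of the possible return times is `1`. -/
def IsAperiodicState (P : S → S → ℝ≥0∞) (x : S) : Prop :=
  ∀ d : ℕ, (∀ k, 1 ≤ k → 0 < stepProb P k x x → d ∣ k) → d = 1

/-- The set `C` of states is closed under the transitions of `P`, and the chain with transition
matrix `P` and state space `C` is irreducible, aperiodic and positive recurrent. -/
structure IsPositiveRecurrentOn (P : S → S → ℝ≥0∞) (C : Set S) : Prop where
  nonempty : C.Nonempty
  closed : ∀ x ∈ C, ∀ y, 0 < P x y → y ∈ C
  irreducible : ∀ x ∈ C, ∀ y ∈ C, y ∈ reachableFrom P x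
  aperiodic : ∀ x ∈ C, IsAperiodicState P x
  positiveRecurrent : ∀ x ∈ C, IsPositiveRecurrentState P x

/-- `X` is a time-homogeneous Markov chain with transition matrix `P`. -/
structure IsMarkovChain {Ω : Type*} [MeasurableSpace Ω] [MeasurableSpace S] (μ : Measure Ω)
    (X : ℕ → Ω → S) (P : S → S → ℝ≥0∞) : Prop where
  measurable : ∀ t, Measurable (X t)
  stochastic : ∀ x, ∑' y, P x y = 1
  markov : ∀ (t : ℕ) (x : ℕ → S),
    μ {ω | ∀ k ≤ t + 1, X k ω = x k} = μ {ω | ∀ k ≤ t, X k ω = x k} * P (x t) (x (t + 1))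

end MarkovChain

/-! ### The input-queued switch -/

/-- `n × n` matrices of natural numbers: queue lengths, arrivals and schedules. -/
abbrev SwitchMat (n : ℕ) : Type := Fin n → Fin n → ℕ

/-- The permutation matrix of `p`, as a schedule. -/
def permSchedule {n : ℕ} (p : Equiv.Perm (Fin n)) : SwitchMat n :=
  fun i j => if p i = j then 1 else 0

/-- The queue lengths `[q + a - s]⁺` after one time slot. Subtraction of natural numbers
is truncated at `0`, which is the positive part. -/
def queueStep {n : ℕ} (q a s : SwitchMat n) : SwitchMat n :=
  fun i j => (q i j + a i j) - s i j

/-- An `n × n` switch with arrivals `a`, schedules `s` and queue lengths `q`, under uniform traffic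
with heavy-traffic parameter `ε`, and under uniformly random scheduling. -/
structure IsRandomSwitch {n : ℕ} {Ω : Type*} [MeasurableSpace Ω] (μ : Measure Ω) (ε : ℝ)
    (a s q : ℕ → Ω → SwitchMat n) : Prop where
  measurable_arrival : ∀ t, Measurable (a t)
  measurable_schedule : ∀ t, Measurable (s t)
  measurable_init : Measurable (q 0)
  /-- The arrivals are independent over time slots and input-output pairs. -/
  indep_arrival : iIndepFun (fun (p : ℕ × Fin n × Fin n) ω => a p.1 ω p.2.1 p.2.2) μ
  /-- For each input-output pair, the arrivals are identically distributed over time. -/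
  ident_arrival : ∀ t i j, IdentDistrib (fun ω => a t ω i j) (fun ω => a 0 ω i j) μ μ
  /-- The arrivals are bounded. -/
  bounded_arrival : ∃ amax : ℕ, ∀ t i j, ∀ᵐ ω ∂μ, a t ω i j ≤ amax
  /-- With positive probability there are no arrivals in a time slot. -/
  no_arrival : ∀ t, 0 < μ {ω | a t ω = 0}
  /-- Uniform traffic: the mean arrival rate matrix is `((1 - ε) / n) • 𝟏`. -/
  mean_arrival : ∀ t i j, ∫ ω, (a t ω i j : ℝ) ∂μ = (1 - ε) / n
  /-- Each schedule is uniformly distributed on the `n!` permutation matrices. -/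
  uniform_schedule : ∀ t (p : Equiv.Perm (Fin n)),
    μ {ω | s t ω = permSchedule p} = ((n.factorial : ℕ) : ℝ≥0∞)⁻¹
  /-- Schedules are drawn afresh in each time slot. -/
  indep_schedule : iIndepFun s μ
  /-- Schedules are drawn independently of the arrivals. -/
  indep_arrival_schedule : IndepFun (fun ω t => a t ω) (fun ω t => s t ω) μ
  /-- The initial queue lengths are independent of all arrivals and schedules. -/
  indep_init : IndepFun (q 0) (fun ω => ((fun t => a t ω), (fun t => s t ω))) μ
  /-- The queue length dynamics. -/
  queue_succ : ∀ t ω, q (t + 1) ω = queueStep (q t ω) (a t ω) (s t ω)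

/-- One-step transition probabilities of the queue lengths: `x` moves to `[x + a - s]⁺`, where `a`
and `s` are the arrivals and the schedule of one time slot. -/
noncomputable def queueTransition {n : ℕ} {Ω : Type*} [MeasurableSpace Ω] (μ : Measure Ω)
    (a s : ℕ → Ω → SwitchMat n) (x y : SwitchMat n) : ℝ≥0∞ :=
  μ {ω | queueStep x (a 0 ω) (s 0 ω) = y}

/-- The sum of all queue lengths. -/
def totalQueue {n : ℕ} (x : SwitchMat n) : ℝ := ∑ i, ∑ j, (x i j : ℝ)

/-- The squared Frobenius norm. -/
def frobeniusSq {n : ℕ} (σ : Fin n → Fin n → ℝ) : ℝ := ∑ i, ∑ j, σ i j ^ 2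

/-- The heavy-traffic performance is MaxWeight-like: the mean total steady-state queue length `m ε`
satisfies `ε * m ε → (1 - 1 / (2 n)) ‖σ‖²` as `ε ↓ 0`. -/
def IsMaxWeightLike {n : ℕ} (m : ℝ → ℝ) (σ : Fin n → Fin n → ℝ) : Prop :=
  Tendsto (fun ε => ε * m ε) (𝓝[>] 0) (𝓝 ((1 - 1 / (2 * (n : ℝ))) * frobeniusSq σ))

/-!
Each queue of the switch is a scalar Lindley recursion `x ↦ (x + a - s)⁺` driven by i.i.d. inputs of
negative mean. Following Loynes, let the inputs run backwards in time: this does not change the law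
of the queue length at time `t`, but makes it monotone in `t` for a queue that starts empty.
Its limit is the law of a stationary switch, and since two switches with the same inputs
eventually agree whatever their initial states, the queue lengths converge to it in distribution.

Kac's inequality turns the stationary law into positive recurrence: the empty switch is reached
from every state, hence has positive stationary mass.

The mean of the stationary law comes from a quadratic Lyapunov function. The function `x (x + 1)` of
a single queue with net input `d = a - s`, `s ≤ 1`, has the exact one-step drift
`2 d x + d ^ 2 + d` whether or not the truncation is active. The long-run average of the mean drift
vanishes, which determines the mean queue length through the first two moments of `d`; `ε` times the
sum over all queues is then an explicit function of `ε` and the arrival variances.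
-/

section MarkovChainTheory

variable {S : Type*} {P : S → S → ℝ≥0∞} {π : S → ℝ≥0∞}

/-- `π` is a stationary measure (not necessarily of mass `1`) of the transition matrix `P`. -/
def IsStationaryMeasure (P : S → S → ℝ≥0∞) (π : S → ℝ≥0∞) : Prop :=
  ∀ y, ∑' x, π x * P x y = π y

variable [DecidableEq S]

/-- The taboo probability that the chain started at `z` does not visit `x` at the times
`1, …, k`. -/
noncomputable def avoidProb (P : S → S → ℝ≥0∞) (x : S) : ℕ → S → ℝ≥0∞
  | 0, _ => 1
  | k + 1, z => ∑' w, if w = x then 0 else P z w * avoidProb P x k w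

theorem add_tsum_ite_zero (f : S → ℝ≥0∞) (x : S) :
    f x + ∑' w, (if w = x then 0 else f w) = ∑' w, f w := by
  rw [ENNReal.tsum_eq_add_tsum_ite (f := f) x]
  congr!

theorem firstPassageProb_succ_add_avoidProb_succ (hP : ∀ x, ∑' y, P x y = 1) (x : S) (k : ℕ)
    (z : S) : firstPassageProb P (k + 1) z x + avoidProb P x (k + 1) z = avoidProb P x k z := by
  induction k generalizing z with
  | zero =>
    simp only [firstPassageProb, avoidProb, mul_one]
    rw [add_tsum_ite_zero (fun w => P z w) x, hP]
  | succ k ih =>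
    have first_step : avoidProb P x (k + 1) z
        = ∑' w, if w = x then 0 else P z w * avoidProb P x k w := rfl
    rw [firstPassageProb, avoidProb, first_step, ← ENNReal.tsum_add]
    refine tsum_congr fun w => ?_
    split_ifs
    · exact add_zero 0
    · rw [← mul_add, ih]

theorem sum_firstPassageProb_add_avoidProb (hP : ∀ x, ∑' y, P x y = 1) (x z : S) (N : ℕ) :
    ∑ k ∈ Finset.range (N + 1), firstPassageProb P k z x + avoidProb P x N z = 1 := by
  induction N with
  | zero => simp [firstPassageProb, avoidProb]
  | succ N ih =>
    rw [Finset.sum_range_succ, add_assoc, firstPassageProb_succ_add_avoidProb_succ hP, ih]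

theorem sum_mul_firstPassageProb_add (hP : ∀ x, ∑' y, P x y = 1) (x z : S) (N : ℕ) :
    ∑ k ∈ Finset.range (N + 1), (k : ℝ≥0∞) * firstPassageProb P k z x + N * avoidProb P x N z
      = ∑ k ∈ Finset.range N, avoidProb P x k z := by
  induction N with
  | zero => simp
  | succ N ih =>
    rw [Finset.sum_range_succ, add_assoc, ← mul_add,
      firstPassageProb_succ_add_avoidProb_succ hP,
      Finset.sum_range_succ (fun k => avoidProb P x k z) N, ← ih, Nat.cast_succ,
      add_mul, one_mul, add_assoc]

namespace IsStationaryMeasure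

theorem add_tsum_mul_avoidProb_succ (hπ : IsStationaryMeasure P π) (x : S) (k : ℕ) :
    π x * avoidProb P x k x + ∑' z, π z * avoidProb P x (k + 1) z
      = ∑' z, π z * avoidProb P x k z := by
  have last_step : ∑' z, π z * avoidProb P x (k + 1) z
      = ∑' w, if w = x then 0 else π w * avoidProb P x k w := by
    simp only [avoidProb, ← ENNReal.tsum_mul_left]
    rw [ENNReal.tsum_comm]
    refine tsum_congr fun w => ?_
    split_ifs
    · simp only [mul_zero, tsum_zero]
    · simp only [← mul_assoc]
      rw [ENNReal.tsum_mul_right, hπ]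
  rw [last_step, add_tsum_ite_zero (fun w => π w * avoidProb P x k w) x]

theorem sum_mul_avoidProb_add (hπ : IsStationaryMeasure P π) (x : S) (N : ℕ) :
    ∑ k ∈ Finset.range N, π x * avoidProb P x k x + ∑' z, π z * avoidProb P x N z
      = ∑' z, π z := by
  induction N with
  | zero => simp [avoidProb]
  | succ N ih => rw [Finset.sum_range_succ, add_assoc, hπ.add_tsum_mul_avoidProb_succ, ih]

/-- The inequality half of Kac's formula. -/
theorem mul_tsum_avoidProb_le (hπ : IsStationaryMeasure P π) (x : S) :
    π x * ∑' k, avoidProb P x k x ≤ ∑' z, π z := by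
  rw [← ENNReal.tsum_mul_left]
  exact ENNReal.tsum_le_of_sum_range_le fun N =>
    hπ.sum_mul_avoidProb_add x N ▸ le_self_add

theorem isPositiveRecurrentState (hπ : IsStationaryMeasure P π) (hP : ∀ x, ∑' y, P x y = 1)
    (hfin : ∑' z, π z ≠ ∞) {x : S} (hx : π x ≠ 0) : IsPositiveRecurrentState P x := by
  have hsum : ∑' k, avoidProb P x k x ≠ ∞ := fun htop => by
    have hle := hπ.mul_tsum_avoidProb_le x
    rw [htop, ENNReal.mul_top hx] at hle
    exact hfin (top_le_iff.1 hle)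
  constructor
  · have hlim : Tendsto (fun N => ∑ k ∈ Finset.range (N + 1), firstPassageProb P k x x
        + avoidProb P x N x) atTop (𝓝 (∑' k, firstPassageProb P k x x + 0)) :=
      ((tendsto_add_atTop_iff_nat 1).2 ENNReal.summable.hasSum.tendsto_sum_nat).add
        (ENNReal.tendsto_atTop_zero_of_tsum_ne_top hsum)
    simp only [sum_firstPassageProb_add_avoidProb hP, add_zero] at hlim
    exact tendsto_nhds_unique hlim tendsto_const_nhds
  · refine lt_of_le_of_lt (ENNReal.tsum_le_of_sum_range_le fun N => ?_) hsum.lt_top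
    calc ∑ k ∈ Finset.range N, (k : ℝ≥0∞) * firstPassageProb P k x x
        ≤ ∑ k ∈ Finset.range (N + 1), (k : ℝ≥0∞) * firstPassageProb P k x x :=
          Finset.sum_le_sum_of_subset (Finset.range_mono (Nat.le_succ N))
      _ ≤ ∑ k ∈ Finset.range N, avoidProb P x k x :=
          sum_mul_firstPassageProb_add hP x x N ▸ le_self_add
      _ ≤ ∑' k, avoidProb P x k x := ENNReal.sum_le_tsum _

theorem tsum_mul_stepProb (hπ : IsStationaryMeasure P π) (k : ℕ) (y : S) :
    ∑' x, π x * stepProb P k x y = π y := by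
  induction k with
  | zero => simp [stepProb]
  | succ k ih =>
    simp only [stepProb, ← ENNReal.tsum_mul_left]
    rw [ENNReal.tsum_comm, ← ih]
    refine tsum_congr fun w => ?_
    simp only [← mul_assoc]
    rw [ENNReal.tsum_mul_right, hπ]

theorem ne_zero_of_mem_reachableFrom (hπ : IsStationaryMeasure P π) {x y : S} (hx : π x ≠ 0)
    (hy : y ∈ reachableFrom P x) : π y ≠ 0 := by
  obtain ⟨k, hk⟩ := hy
  rw [← hπ.tsum_mul_stepProb k y]
  exact ((ENNReal.mul_pos hx hk.ne').trans_le (ENNReal.le_tsum x)).ne'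

end IsStationaryMeasure

theorem stepProb_one (x y : S) : stepProb P 1 x y = P x y := by
  simp [stepProb]

theorem stepProb_mul_stepProb_le (j k : ℕ) (x y z : S) :
    stepProb P j x y * stepProb P k y z ≤ stepProb P (j + k) x z := by
  induction j generalizing x with
  | zero =>
    by_cases hxy : x = y
    · simp [stepProb, hxy]
    · simp [stepProb, hxy]
  | succ j ih =>
    rw [Nat.succ_add, stepProb, stepProb, ← ENNReal.tsum_mul_right]
    refine ENNReal.tsum_le_tsum fun w => ?_
    rw [mul_assoc]
    gcongr
    exact ih w

theorem stepProb_add_pos {j k : ℕ} {x y z : S} (hxy : 0 < stepProb P j x y)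
    (hyz : 0 < stepProb P k y z) : 0 < stepProb P (j + k) x z :=
  (ENNReal.mul_pos hxy.ne' hyz.ne').trans_le (stepProb_mul_stepProb_le j k x y z)

theorem stepProb_self_pos {x : S} (hx : 0 < P x x) (m : ℕ) : 0 < stepProb P m x x := by
  induction m with
  | zero => simp [stepProb]
  | succ m ih => exact stepProb_add_pos ih (by rwa [stepProb_one])

theorem mem_reachableFrom_self (x : S) : x ∈ reachableFrom P x := ⟨0, by simp [stepProb]⟩

theorem mem_reachableFrom_trans {x y z : S} (hxy : y ∈ reachableFrom P x)
    (hyz : z ∈ reachableFrom P y) : z ∈ reachableFrom P x := by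
  obtain ⟨j, hj⟩ := hxy
  obtain ⟨k, hk⟩ := hyz
  exact ⟨j + k, stepProb_add_pos hj hk⟩

theorem mem_reachableFrom_of_pos {x y : S} (hxy : 0 < P x y) : y ∈ reachableFrom P x :=
  ⟨1, by rwa [stepProb_one]⟩

theorem isAperiodicState_of_reachable_loop {o x : S} (ho : 0 < P o o)
    (hxo : o ∈ reachableFrom P x) (hox : x ∈ reachableFrom P o) : IsAperiodicState P x := by
  intro d hd
  obtain ⟨j, hj⟩ := hxo
  obtain ⟨k, hk⟩ := hox
  have cycle (m : ℕ) : 0 < stepProb P (j + m + k) x x :=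
    stepProb_add_pos (stepProb_add_pos hj (stepProb_self_pos ho m)) hk
  have hd₁ : d ∣ j + 1 + k := hd _ (by omega) (cycle 1)
  have hd₂ : d ∣ (j + 1 + k) + 1 := by
    rw [show j + 1 + k + 1 = j + 2 + k by omega]
    exact hd _ (by omega) (cycle 2)
  exact Nat.dvd_one.1 ((Nat.dvd_add_right hd₁).1 hd₂)

theorem isPositiveRecurrentOn_reachableFrom (hP : ∀ x, ∑' y, P x y = 1) {o : S}
    (ho : 0 < P o o) (hreach : ∀ x, o ∈ reachableFrom P x) (hπ : IsStationaryMeasure P π)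
    (hπ_one : ∑' z, π z = 1) : IsPositiveRecurrentOn P (reachableFrom P o) where
  nonempty := ⟨o, mem_reachableFrom_self o⟩
  closed _ hx _ hxy := mem_reachableFrom_trans hx (mem_reachableFrom_of_pos hxy)
  irreducible x _ _ hy := mem_reachableFrom_trans (hreach x) hy
  aperiodic x hx := isAperiodicState_of_reachable_loop ho (hreach x) hx
  positiveRecurrent x hx := by
    obtain ⟨z, hz⟩ : ∃ z, π z ≠ 0 := by
      by_contra! hzero
      simp [hzero] at hπ_one
    exact hπ.isPositiveRecurrentState hP (hπ_one ▸ ENNReal.one_ne_top)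
      (hπ.ne_zero_of_mem_reachableFrom hz (mem_reachableFrom_trans (hreach z) hx))

end MarkovChainTheory

section Independence

theorem preimage_finset_pi {Ω ι : Type*} {δ : ι → Type*}
    (Z : ∀ i, Ω → δ i) (I : Finset ι) (D : ∀ i, Set (δ i)) :
    (fun ω i => Z i ω) ⁻¹' Set.pi I D = ⋂ i ∈ I, Z i ⁻¹' D i := by
  ext
  simp

variable {Ω ι κ : Type*} [MeasurableSpace Ω] {μ : Measure Ω}

theorem iIndepFun_of_isPiSystem [IsProbabilityMeasure μ] {β : ι → Type*}
    [mβ : ∀ i, MeasurableSpace (β i)] {X : ∀ i, Ω → β i} (hX : ∀ i, Measurable (X i))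
    {C : ∀ i, Set (Set (β i))} (hC : ∀ i, IsPiSystem (C i))
    (hgen : ∀ i, MeasurableSpace.generateFrom (C i) = mβ i)
    (hmul : ∀ (I : Finset ι) (A : ∀ i, Set (β i)), (∀ i ∈ I, A i ∈ C i) →
      μ (⋂ i ∈ I, X i ⁻¹' A i) = ∏ i ∈ I, μ (X i ⁻¹' A i)) :
    iIndepFun X μ := by
  refine iIndepSets.iIndep (m := fun i => (mβ i).comap (X i)) (fun i => (hX i).comap_le)
    (π := fun i => {s | ∃ A ∈ C i, X i ⁻¹' A = s}) (fun i => (hC i).comap (X i)) (fun i => ?_)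
    ((iIndepSets_iff _ _).2 fun I B hB => ?_)
  · rw [← hgen i, MeasurableSpace.comap_generateFrom]
    rfl
  · choose! A hA hAB using hB
    rw [Set.iInter₂_congr fun i hi => (hAB i hi).symm, hmul I A hA,
      Finset.prod_congr rfl fun i hi => by rw [hAB i hi]]

theorem iIndepFun_prodMk {β γ : ι → Type*} [∀ i, MeasurableSpace (β i)]
    [∀ i, MeasurableSpace (γ i)] {X : ∀ i, Ω → β i} {Y : ∀ i, Ω → γ i}
    (hX : ∀ i, Measurable (X i)) (hY : ∀ i, Measurable (Y i)) (hX_indep : iIndepFun X μ)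
    (hY_indep : iIndepFun Y μ) (hXY : IndepFun (fun ω i => X i ω) (fun ω i => Y i ω) μ) :
    iIndepFun (fun i ω => (X i ω, Y i ω)) μ := by
  have := hX_indep.isProbabilityMeasure
  refine iIndepFun_of_isPiSystem (fun i => (hX i).prodMk (hY i)) (fun _ => isPiSystem_prod)
    (fun _ => generateFrom_prod) fun I R hR => ?_
  choose! A hA B hB hAB using hR
  have hI : ∀ i ∈ I, (fun ω => (X i ω, Y i ω)) ⁻¹' R i = X i ⁻¹' A i ∩ Y i ⁻¹' B i :=
    fun i hi => by rw [← hAB i hi, Set.mk_preimage_prod]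
  rw [Set.iInter₂_congr hI, Finset.prod_congr rfl fun i hi => congrArg μ (hI i hi)]
  simp only [Set.iInter_inter_distrib]
  rw [← preimage_finset_pi, ← preimage_finset_pi, hXY.measure_inter_preimage_eq_mul _ _
    (.pi I.countable_toSet hA) (.pi I.countable_toSet hB), preimage_finset_pi, preimage_finset_pi,
    hX_indep.measure_inter_preimage_eq_mul I hA, hY_indep.measure_inter_preimage_eq_mul I hB,
    ← Finset.prod_mul_distrib]
  refine Finset.prod_congr rfl fun i hi => ?_
  have hXYi : IndepFun (X i) (Y i) μ := hXY.comp (measurable_pi_apply i) (measurable_pi_apply i)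
  exact (hXYi.measure_inter_preimage_eq_mul _ _ (hA i hi) (hB i hi)).symm

theorem iIndepFun_curry [Finite κ] {β : Type*} [MeasurableSpace β] {X : ι → κ → Ω → β}
    (hX : ∀ i k, Measurable (X i k)) (hX_indep : iIndepFun (fun p : ι × κ => X p.1 p.2) μ) :
    iIndepFun (fun i ω k => X i k ω) μ := by
  have := hX_indep.isProbabilityMeasure
  have := Fintype.ofFinite κ
  refine iIndepFun_of_isPiSystem (fun i => measurable_pi_lambda _ (hX i))
    (fun _ => isPiSystem_pi) (fun _ => generateFrom_pi) fun I R hR => ?_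
  choose! A hA hAR using hR
  have hI : ∀ i ∈ I, (fun ω k => X i k ω) ⁻¹' R i = ⋂ k ∈ Finset.univ, X i k ⁻¹' A i k :=
    fun i hi => by rw [← hAR i hi]; ext; simp
  have hprod : ∀ J : Finset ι, (∀ i ∈ J, i ∈ I) →
      μ (⋂ i ∈ J, ⋂ k ∈ Finset.univ, X i k ⁻¹' A i k) = ∏ i ∈ J, ∏ k, μ (X i k ⁻¹' A i k) := by
    intro J hJ
    rw [← Finset.prod_product', ← hX_indep.measure_inter_preimage_eq_mul (J ×ˢ Finset.univ)
      (sets := fun p => A p.1 p.2)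
      fun p hp => hA p.1 (hJ p.1 (Finset.mem_product.1 hp).1) p.2 (Set.mem_univ _)]
    congr 1
    ext
    simp only [Finset.mem_univ, Set.iInter_true, Set.mem_iInter, Set.mem_preimage,
      Finset.mem_product, and_true, Prod.forall]
    exact forall_congr' fun i => forall_comm
  rw [Set.iInter₂_congr hI, hprod I fun _ => id]
  refine Finset.prod_congr rfl fun i hi => ?_
  simpa [hI i hi] using (hprod {i} (by simpa using hi)).symm

end Independence

section IID

variable {Ω V : Type*} [MeasurableSpace Ω] {μ : Measure Ω} [MeasurableSpace V] {W : ℕ → Ω → V}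

/-- `W 0, W 1, …` are independent, identically distributed random variables. -/
structure IsIID (μ : Measure Ω) (W : ℕ → Ω → V) : Prop where
  measurable : ∀ t, Measurable (W t)
  indep : iIndepFun W μ
  ident : ∀ t, IdentDistrib (W t) (W 0) μ μ

namespace IsIID

theorem measurable_process (hW : IsIID μ W) : Measurable fun ω t => W t ω :=
  measurable_pi_lambda _ hW.measurable

theorem comp {V' : Type*} [MeasurableSpace V'] (hW : IsIID μ W) {f : V → V'}
    (hf : Measurable f) : IsIID μ (fun t ω => f (W t ω)) where
  measurable t := hf.comp (hW.measurable t)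
  indep := hW.indep.comp (fun _ => f) fun _ => hf
  ident t := (hW.ident t).comp hf

theorem prodMk {V' : Type*} [MeasurableSpace V'] {Y : ℕ → Ω → V'} (hW : IsIID μ W)
    (hY : IsIID μ Y) (hWY : IndepFun (fun ω t => W t ω) (fun ω t => Y t ω) μ) :
    IsIID μ (fun t ω => (W t ω, Y t ω)) where
  measurable t := (hW.measurable t).prodMk (hY.measurable t)
  indep := iIndepFun_prodMk hW.measurable hY.measurable hW.indep hY.indep hWY
  ident t :=
    have := hW.indep.isProbabilityMeasure
    have hindep (k : ℕ) : IndepFun (W k) (Y k) μ :=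
      hWY.comp (measurable_pi_apply k) (measurable_pi_apply k)
    (hW.ident t).prodMk (hY.ident t) (hindep t) (hindep 0)

theorem ae_all (hW : IsIID μ W) {p : V → Prop} (hp : MeasurableSet {v | p v})
    (h : ∀ᵐ ω ∂μ, p (W 0 ω)) : ∀ᵐ ω ∂μ, ∀ t, p (W t ω) :=
  ae_all_iff.2 fun t => (hW.ident t).symm.ae_snd hp h

theorem reindex (hW : IsIID μ W) {σ : ℕ → ℕ} (hσ : σ.Injective) :
    IsIID μ (fun t => W (σ t)) where
  measurable t := hW.measurable (σ t)
  indep := hW.indep.precomp hσ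
  ident t := (hW.ident (σ t)).trans (hW.ident (σ 0)).symm

theorem identDistrib_reindex (hW : IsIID μ W) {σ : ℕ → ℕ} (hσ : σ.Injective) :
    IdentDistrib (fun ω t => W (σ t) ω) (fun ω t => W t ω) μ μ :=
  .pi (fun t => (hW.ident (σ t)).trans (hW.ident t).symm) (hW.reindex hσ).indep hW.indep

theorem indepFun_shift (hW : IsIID μ W) : IndepFun (fun ω t => W (t + 1) ω) (W 0) μ := by
  have := hW.indep.isProbabilityMeasure
  refine IndepFun.process_indepFun (fun t => hW.measurable (t + 1)) (hW.measurable 0) fun I => ?_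
  have hdisj : Disjoint (I.map (addRightEmbedding 1)) {0} := by simp
  have htail : Measurable fun (w : I.map (addRightEmbedding 1) → V) (t : I) =>
      w ⟨t + 1, by simp⟩ := measurable_pi_lambda _ fun _ => measurable_pi_apply _
  have hhead : Measurable fun w : ({0} : Finset ℕ) → V => w ⟨0, by simp⟩ := measurable_pi_apply _
  exact (hW.indep.indepFun_finset _ _ hdisj hW.measurable).comp htail hhead

end IsIID

end IID

section Orbits

variable {S T V U : Type*} {F : S → V → S} {w w' : ℕ → V}

/-- The orbit of the recursion `x ↦ F x v` that starts at `x` and takes the inputs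
`w 0, w 1, …` in this order. -/
def drivenOrbit (F : S → V → S) (x : S) (w : ℕ → V) : ℕ → S
  | 0 => x
  | t + 1 => F (drivenOrbit F x w t) (w t)

/-- Loynes' backward orbit: `t` steps of the recursion `x ↦ F x v`, with the inputs
`w (t - 1), …, w 1, w 0` in this order. Increasing `t` moves the start into the past and keeps
the last input, so that the orbits of a monotone recursion are monotone in `t`. -/
def backwardOrbit (F : S → V → S) (x : S) (t : ℕ) (w : ℕ → V) : S :=
  drivenOrbit F x (fun k => w (t - 1 - k)) t

theorem eq_drivenOrbit {Ω : Type*} {X : ℕ → Ω → S} {W : ℕ → Ω → V}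
    (hX : ∀ t ω, X (t + 1) ω = F (X t ω) (W t ω)) (t : ℕ) :
    X t = fun ω => drivenOrbit F (X 0 ω) (fun k => W k ω) t := by
  ext ω
  induction t with
  | zero => rfl
  | succ t ih => rw [hX, drivenOrbit, ← ih]

theorem drivenOrbit_congr (x : S) {t : ℕ} (h : ∀ k < t, w k = w' k) :
    drivenOrbit F x w t = drivenOrbit F x w' t := by
  induction t with
  | zero => rfl
  | succ t ih =>
    rw [drivenOrbit, drivenOrbit, ih fun k hk => h k (hk.trans t.lt_succ_self), h t t.lt_succ_self]

theorem drivenOrbit_succ' (x : S) (t : ℕ) :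
    drivenOrbit F x w (t + 1) = drivenOrbit F (F x (w 0)) (fun k => w (k + 1)) t := by
  induction t with
  | zero => rfl
  | succ t ih => rw [drivenOrbit, ih, drivenOrbit]

theorem map_drivenOrbit {G : T → U → T} {φ : S → T} {ψ : V → U}
    (h : ∀ x v, φ (F x v) = G (φ x) (ψ v)) (x : S) (t : ℕ) :
    φ (drivenOrbit F x w t) = drivenOrbit G (φ x) (fun k => ψ (w k)) t := by
  induction t with
  | zero => rfl
  | succ t ih => rw [drivenOrbit, h, ih, drivenOrbit]

theorem monotone_drivenOrbit [Preorder S] (hF : ∀ v, Monotone fun x => F x v) (t : ℕ) :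
    Monotone fun x => drivenOrbit F x w t := by
  induction t with
  | zero => exact monotone_id
  | succ t ih => exact (hF _).comp ih

theorem backwardOrbit_succ (x : S) (t : ℕ) :
    backwardOrbit F x (t + 1) w = F (backwardOrbit F x t fun k => w (k + 1)) (w 0) := by
  rw [backwardOrbit, drivenOrbit, backwardOrbit, Nat.add_sub_cancel, Nat.sub_self]
  congr 1
  exact drivenOrbit_congr x fun k hk => congrArg w (by omega)

theorem monotone_backwardOrbit [Preorder S] (hF : ∀ v, Monotone fun x => F x v) {x : S}
    (hx : ∀ v, x ≤ F x v) : Monotone fun t => backwardOrbit F x t w := by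
  refine monotone_nat_of_le_succ fun t => ?_
  simp only [backwardOrbit]
  rw [drivenOrbit_succ', drivenOrbit_congr (F x _) fun k _ =>
    congrArg w (show t + 1 - 1 - (k + 1) = t - 1 - k by omega)]
  exact monotone_drivenOrbit hF t (hx _)

variable [MeasurableSpace S] [MeasurableSpace V]

theorem measurable_drivenOrbit (hF : Measurable F.uncurry) (t : ℕ) :
    Measurable fun p : S × (ℕ → V) => drivenOrbit F p.1 p.2 t := by
  induction t with
  | zero => exact measurable_fst
  | succ t ih => exact hF.comp (ih.prodMk ((measurable_pi_apply t).comp measurable_snd))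

theorem measurable_backwardOrbit (hF : Measurable F.uncurry) (x : S) (t : ℕ) :
    Measurable (backwardOrbit F x t) :=
  (measurable_drivenOrbit hF t).comp (measurable_const.prodMk
    (measurable_pi_lambda _ fun _ => measurable_pi_apply _))

end Orbits

section RandomRecursion

variable {S V Ω : Type*} [MeasurableSpace Ω] {μ : Measure Ω} {F : S → V → S} {W : ℕ → Ω → V}

/-- The transition matrix of the random recursion `x ↦ F x v` whose input has the law of `v`. -/
noncomputable def transitionProb (μ : Measure Ω) (F : S → V → S) (v : Ω → V) (x y : S) : ℝ≥0∞ :=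
  μ {ω | F x (v ω) = y}

theorem ae_transitionProb_pos [Countable S] (v : Ω → V) :
    ∀ᵐ ω ∂μ, ∀ x, 0 < transitionProb μ F v x (F x (v ω)) := by
  have hnull (x : S) : ∀ᵐ ω ∂μ, ∀ y, transitionProb μ F v x y = 0 → F x (v ω) ≠ y :=
    ae_all_iff.2 fun y => eventually_imp_distrib_left.2 measure_eq_zero_iff_ae_notMem.1
  filter_upwards [ae_all_iff.2 hnull] with ω hω x
  exact pos_iff_ne_zero.2 fun h => hω x _ h rfl

theorem tsum_measure_eq [Countable S] [MeasurableSpace S] [MeasurableSingletonClass S]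
    {Y : Ω → S} (hY : Measurable Y) : ∑' y, μ {ω | Y ω = y} = μ Set.univ := by
  have h := tsum_measure_preimage_singleton (μ := μ) (Set.to_countable Set.univ)
    fun y _ => hY (measurableSet_singleton y)
  rwa [tsum_univ fun y => μ (Y ⁻¹' {y})] at h

variable [MeasurableSpace S] [MeasurableSpace V]

/-- Reversing the order of the first `t` inputs does not change the law of the input sequence. -/
theorem IsIID.identDistrib_backwardOrbit (hW : IsIID μ W) (hF : Measurable F.uncurry)
    {X : ℕ → Ω → S} (hX₀_meas : Measurable (X 0)) (hX₀ : IndepFun (X 0) (fun ω t => W t ω) μ)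
    (hX : ∀ t ω, X (t + 1) ω = F (X t ω) (W t ω)) (t : ℕ) :
    IdentDistrib (fun ω => backwardOrbit F (X 0 ω) t fun k => W k ω) (X t) μ μ := by
  have := hW.indep.isProbabilityMeasure
  let σ (k : ℕ) : ℕ := if k < t then t - 1 - k else k
  have hσ : σ.Injective := fun j k hjk => by grind
  have hσX : IndepFun (X 0) (fun ω k => W (σ k) ω) μ :=
    hX₀.comp measurable_id (measurable_pi_lambda _ fun k => measurable_pi_apply (σ k))
  have hpair := (IdentDistrib.refl hX₀_meas.aemeasurable).prodMk
    (hW.identDistrib_reindex hσ) hσX hX₀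
  convert hpair.comp (measurable_drivenOrbit hF t) using 1
  · ext ω
    exact drivenOrbit_congr _ fun k hk => congrArg (W · ω) (if_pos hk).symm
  · exact eq_drivenOrbit hX t

theorem IsIID.tendstoInDistribution_of_backwardOrbit [TopologicalSpace S] [OpensMeasurableSpace S]
    [IsProbabilityMeasure μ] (hW : IsIID μ W) (hF : Measurable F.uncurry) {X : ℕ → Ω → S}
    (hX₀_meas : Measurable (X 0)) (hX₀ : IndepFun (X 0) (fun ω t => W t ω) μ)
    (hX : ∀ t ω, X (t + 1) ω = F (X t ω) (W t ω)) {Z : Ω → S} (hZ : AEMeasurable Z μ)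
    (hlim : ∀ᵐ ω ∂μ, Tendsto (fun t => backwardOrbit F (X 0 ω) t fun k => W k ω) atTop (𝓝 (Z ω))) :
    TendstoInDistribution X atTop Z (fun _ => μ) μ := by
  have hident := hW.identDistrib_backwardOrbit hF hX₀_meas hX₀ hX
  have hconv := tendstoInDistribution_of_ae_tendsto (fun t => (hident t).aemeasurable_fst) hZ hlim
  refine ⟨fun t => (hident t).aemeasurable_snd, hZ, hconv.tendsto.congr fun t => ?_⟩
  exact Subtype.ext (hident t).map_eq

variable [MeasurableSingletonClass S]

theorem IsIID.measure_path (hW : IsIID μ W)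
    (hF : ∀ x, Measurable (F x)) {X : ℕ → Ω → S} (hX₀ : IndepFun (X 0) (fun ω t => W t ω) μ)
    (hX : ∀ t ω, X (t + 1) ω = F (X t ω) (W t ω)) (t : ℕ) (x : ℕ → S) :
    μ {ω | ∀ k ≤ t, X k ω = x k} =
      μ {ω | X 0 ω = x 0} * ∏ k ∈ Finset.range t, transitionProb μ F (W 0) (x k) (x (k + 1)) := by
  have hD (k : ℕ) : MeasurableSet {v | F (x k) v = x (k + 1)} := hF _ (measurableSet_singleton _)
  have hpath : {ω | ∀ k ≤ t, X k ω = x k} = X 0 ⁻¹' {x 0} ∩ (fun ω k => W k ω) ⁻¹'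
      Set.pi (Finset.range t) fun k => {v | F (x k) v = x (k + 1)} := by
    ext ω
    simp only [Set.mem_ofPred_eq, Set.mem_inter_iff, Set.mem_preimage, Set.mem_singleton_iff,
      Set.mem_pi, Finset.coe_range, Set.mem_Iio]
    refine ⟨fun h => ⟨h 0 t.zero_le, fun k hk => ?_⟩, fun ⟨h₀, h⟩ k hk => ?_⟩
    · rw [← h k hk.le, ← hX, h (k + 1) hk]
    · induction k with
      | zero => exact h₀
      | succ k ih => rw [hX, ih (by omega), h k (by omega)]
  rw [hpath, hX₀.measure_inter_preimage_eq_mul _ _ (measurableSet_singleton _)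
    (.pi (Finset.range t).countable_toSet fun k _ => hD k), preimage_finset_pi,
    hW.indep.measure_inter_preimage_eq_mul _ fun k _ => hD k]
  congr 1
  exact Finset.prod_congr rfl fun k _ => (hW.ident k).measure_mem_eq (hD k)

variable [Countable S]

theorem tsum_transitionProb [IsProbabilityMeasure μ] (hF : ∀ x, Measurable (F x)) {v : Ω → V}
    (hv : Measurable v) (x : S) : ∑' y, transitionProb μ F v x y = 1 :=
  (tsum_measure_eq ((hF x).comp hv)).trans measure_univ

theorem tsum_mul_transitionProb (hF : ∀ x, Measurable (F x)) {Y : Ω → S} (hY : Measurable Y)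
    {v : Ω → V} (hYv : IndepFun Y v μ) (y : S) :
    ∑' x, μ {ω | Y ω = x} * transitionProb μ F v x y = μ {ω | F (Y ω) (v ω) = y} := by
  rw [← Measure.restrict_apply_univ, ← tsum_measure_eq hY]
  refine tsum_congr fun x => ?_
  have hx : MeasurableSet {ω | Y ω = x} := hY (measurableSet_singleton x)
  rw [Measure.restrict_apply hx]
  refine (hYv.measure_inter_preimage_eq_mul {x} {v | F x v = y} (measurableSet_singleton x)
    (hF x (measurableSet_singleton y))).symm.trans (congrArg μ ?_)
  ext ω
  exact and_congr_right fun (h : Y ω = x) => h ▸ Iff.rfl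

namespace IsIID

theorem isMarkovChain (hW : IsIID μ W) (hF : Measurable F.uncurry) {X : ℕ → Ω → S}
    (hX₀_meas : Measurable (X 0)) (hX₀ : IndepFun (X 0) (fun ω t => W t ω) μ)
    (hX : ∀ t ω, X (t + 1) ω = F (X t ω) (W t ω)) :
    IsMarkovChain μ X (transitionProb μ F (W 0)) where
  measurable t := by
    rw [eq_drivenOrbit hX t]
    exact (measurable_drivenOrbit hF t).comp (hX₀_meas.prodMk hW.measurable_process)
  stochastic :=
    have := hW.indep.isProbabilityMeasure
    tsum_transitionProb (fun _ => hF.of_uncurry_left) (hW.measurable 0)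
  markov t x := by
    have hFx (x : S) : Measurable (F x) := hF.of_uncurry_left
    rw [hW.measure_path hFx hX₀ hX, hW.measure_path hFx hX₀ hX, Finset.prod_range_succ, mul_assoc]

theorem ae_drivenOrbit_mem_reachableFrom [DecidableEq S] (hW : IsIID μ W)
    (hF : Measurable F.uncurry) (x : S) :
    ∀ᵐ ω ∂μ, ∀ t,
      drivenOrbit F x (fun k => W k ω) t ∈ reachableFrom (transitionProb μ F (W 0)) x := by
  have hmeas : MeasurableSet {v | ∀ x, 0 < transitionProb μ F (W 0) x (F x v)} := by
    simp only [Set.ofPred_forall]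
    exact .iInter fun x =>
      (measurable_to_countable' (f := F x) fun y => hF.of_uncurry_left (measurableSet_singleton y))
        (Set.to_countable {y | 0 < transitionProb μ F (W 0) x y}).measurableSet
  filter_upwards [hW.ae_all hmeas (ae_transitionProb_pos (W 0))] with ω hω t
  induction t with
  | zero => exact mem_reachableFrom_self x
  | succ t ih => exact mem_reachableFrom_trans ih (mem_reachableFrom_of_pos (hω t _))

/-- Loynes' construction: a limit of the backward orbits started in the remote past satisfies the
recursion, because the past of the shifted input sequence is extended by the input `W 0`. -/
theorem ae_limit_backwardOrbit_eq (hW : IsIID μ W) (hF : Measurable F.uncurry) {x : S}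
    {M : (ℕ → V) → S} (hM : Measurable M)
    (hlim : ∀ᵐ ω ∂μ, ∀ᶠ t in atTop, backwardOrbit F x t (fun k => W k ω) = M fun k => W k ω) :
    ∀ᵐ ω ∂μ, M (fun k => W k ω) = F (M fun k => W (k + 1) ω) (W 0 ω) := by
  have hmeas : MeasurableSet {w | ∀ᶠ t in atTop, backwardOrbit F x t w = M w} := by
    simp only [eventually_atTop, Set.ofPred_exists, Set.ofPred_forall]
    exact .iUnion fun _ => .iInter fun t => .iInter fun _ =>
      measurableSet_eq_fun (measurable_backwardOrbit hF x t) hM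
  have hshift : ∀ᵐ ω ∂μ, ∀ᶠ t in atTop,
      backwardOrbit F x t (fun k => W (k + 1) ω) = M fun k => W (k + 1) ω :=
    (hW.identDistrib_reindex (add_left_injective 1)).symm.ae_snd hmeas hlim
  filter_upwards [hlim, hshift] with ω hω hωs
  obtain ⟨t, ht, hts⟩ := (((tendsto_add_atTop_nat 1).eventually hω).and hωs).exists
  rw [← ht, backwardOrbit_succ, hts]

theorem isStationaryMeasure_limit_backwardOrbit (hW : IsIID μ W) (hF : Measurable F.uncurry)
    {x : S} {M : (ℕ → V) → S} (hM : Measurable M)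
    (hlim : ∀ᵐ ω ∂μ, ∀ᶠ t in atTop, backwardOrbit F x t (fun k => W k ω) = M fun k => W k ω) :
    IsStationaryMeasure (transitionProb μ F (W 0)) fun y => μ {ω | M (fun k => W k ω) = y} := by
  intro y
  have hM_shift : IdentDistrib (fun ω => M fun k => W (k + 1) ω) (fun ω => M fun k => W k ω) μ μ :=
    (hW.identDistrib_reindex (add_left_injective 1)).comp hM
  have hindep : IndepFun (fun ω => M fun k => W (k + 1) ω) (W 0) μ :=
    hW.indepFun_shift.comp hM measurable_id
  calc ∑' z, μ {ω | M (fun k => W k ω) = z} * transitionProb μ F (W 0) z y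
      = ∑' z, μ {ω | M (fun k => W (k + 1) ω) = z} * transitionProb μ F (W 0) z y :=
        tsum_congr fun z => congrArg (· * _)
          (hM_shift.measure_mem_eq (measurableSet_singleton z)).symm
    _ = μ {ω | F (M fun k => W (k + 1) ω) (W 0 ω) = y} :=
        tsum_mul_transitionProb (fun _ => hF.of_uncurry_left)
          (hM.comp (measurable_pi_lambda _ fun k => hW.measurable (k + 1))) hindep y
    _ = μ {ω | M (fun k => W k ω) = y} := by
        refine measure_congr ?_
        filter_upwards [hW.ae_limit_backwardOrbit_eq hF hM hlim] with ω hω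
        exact congrArg (· = y) hω.symm

end IsIID

end RandomRecursion

section LindleyRecursion

/-- One step of the Lindley recursion of a single-server queue: `v = (a, s)` consists of the
arrivals `a` and the offered service `s`. The truncated subtraction is the positive part. -/
def lindleyStep (x : ℕ) (v : ℕ × ℕ) : ℕ := x + v.1 - v.2

/-- The arrivals minus the offered service. -/
def netInput (v : ℕ × ℕ) : ℝ := v.1 - v.2

theorem monotone_lindleyStep (v : ℕ × ℕ) : Monotone fun x => lindleyStep x v :=
  fun _ _ hxy => Nat.sub_le_sub_right (Nat.add_le_add_right hxy _) _

variable {w : ℕ → ℕ × ℕ}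

theorem coe_drivenOrbit_lindleyStep (x t : ℕ) :
    ((drivenOrbit lindleyStep x w t : ℕ) : ℤ) = max ((drivenOrbit lindleyStep 0 w t : ℕ) : ℤ)
      (x + ∑ k ∈ Finset.range t, ((w k).1 - (w k).2 : ℤ)) := by
  induction t with
  | zero => simp [drivenOrbit]
  | succ t ih =>
    rw [Finset.sum_range_succ]
    simp only [drivenOrbit, lindleyStep]
    omega

theorem coe_backwardOrbit_lindleyStep (x t : ℕ) :
    ((backwardOrbit lindleyStep x t w : ℕ) : ℤ) = max ((backwardOrbit lindleyStep 0 t w : ℕ) : ℤ)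
      (x + ∑ k ∈ Finset.range t, ((w k).1 - (w k).2 : ℤ)) := by
  rw [← Finset.sum_range_reflect]
  exact coe_drivenOrbit_lindleyStep x t

theorem eventually_lindleyStep_orbit_eq
    (hw : Tendsto (fun t => ∑ k ∈ Finset.range t, netInput (w k)) atTop atBot) (x : ℕ) :
    ∀ᶠ t in atTop, drivenOrbit lindleyStep x w t = drivenOrbit lindleyStep 0 w t ∧
      backwardOrbit lindleyStep x t w = backwardOrbit lindleyStep 0 t w := by
  filter_upwards [hw.eventually_le_atBot (-x)] with t ht
  have hsum : x + ∑ k ∈ Finset.range t, ((w k).1 - (w k).2 : ℤ) ≤ 0 := by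
    have : (x : ℝ) + ∑ k ∈ Finset.range t, ((w k).1 - (w k).2 : ℝ) ≤ 0 := by
      simp only [netInput] at ht
      linarith
    exact_mod_cast this
  have hdriven := coe_drivenOrbit_lindleyStep (w := w) x t
  have hbackward := coe_backwardOrbit_lindleyStep (w := w) x t
  omega

theorem backwardOrbit_lindleyStep_le {K : ℕ} (hw : ∀ k, (w k).1 ≤ K) (t : ℕ) :
    backwardOrbit lindleyStep 0 t w ≤ K * t := by
  induction t generalizing w with
  | zero => exact Nat.zero_le _
  | succ t ih =>
    rw [backwardOrbit_succ, Nat.mul_succ]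
    exact (Nat.sub_le _ _).trans (Nat.add_le_add (ih fun k => hw (k + 1)) (hw 0))

/-- The Lyapunov function of the drift argument. Because of the linear term, its increments in
`queuePotential_lindleyStep` do not involve the unused service. -/
def queuePotential (x : ℕ) : ℝ := x * (x + 1)

theorem queuePotential_lindleyStep (x : ℕ) {v : ℕ × ℕ} (hv : v.2 ≤ 1) :
    queuePotential (lindleyStep x v) =
      queuePotential x + 2 * (x * netInput v) + (netInput v ^ 2 + netInput v) := by
  obtain ⟨a, s⟩ := v
  rcases Nat.le_one_iff_eq_zero_or_eq_one.1 hv with rfl | rfl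
  · simp [queuePotential, lindleyStep, netInput]
    ring
  · rcases hxa : x + a with _ | m
    · obtain ⟨rfl, rfl⟩ := Nat.add_eq_zero_iff.1 hxa
      simp [queuePotential, lindleyStep, netInput]
    · have hm : (m : ℝ) = x + a - 1 := by
        rw [eq_sub_iff_add_eq]
        exact_mod_cast hxa.symm
      simp only [queuePotential, lindleyStep, netInput, hxa, Nat.add_sub_cancel, hm, Nat.cast_one]
      ring

end LindleyRecursion

section MonotoneSequences

theorem le_two_mul_of_sum_range_le {f : ℕ → ℝ} (hf : Monotone f) (hf₀ : ∀ t, 0 ≤ f t) {C : ℝ}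
    (hC : ∀ t, ∑ k ∈ Finset.range t, f k ≤ C * t) (t : ℕ) : f t ≤ 2 * C := by
  have hpos : (0 : ℝ) < t + 1 := by positivity
  refine le_of_mul_le_mul_left ?_ hpos
  calc (t + 1) * f t
      = ∑ _k ∈ Finset.range (t + 1), f t := by simp
    _ ≤ ∑ k ∈ Finset.range (t + 1), f (t + 1 + k) :=
        Finset.sum_le_sum fun k _ => hf (by omega)
    _ ≤ ∑ k ∈ Finset.range (t + 1 + (t + 1)), f k := by
        rw [Finset.sum_range_add _ (t + 1)]
        exact le_add_of_nonneg_left (Finset.sum_nonneg fun k _ => hf₀ k)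
    _ ≤ C * ((t + 1 + (t + 1) : ℕ) : ℝ) := hC _
    _ = (t + 1) * (2 * C) := by push_cast; ring

variable {Ω : Type*} [MeasurableSpace Ω] {μ : Measure Ω}

theorem integrable_comp_of_ae_mem_finite {S : Type*} [Countable S] [MeasurableSpace S]
    [MeasurableSingletonClass S] [IsFiniteMeasure μ] {Y : Ω → S} (hY : Measurable Y) {s : Set S}
    (hs : s.Finite) (hYs : ∀ᵐ ω ∂μ, Y ω ∈ s) (f : S → ℝ) : Integrable (fun ω => f (Y ω)) μ := by
  obtain ⟨C, hC⟩ := (hs.image fun x => ‖f x‖).bddAbove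
  have hf : Measurable f := Measurable.of_discrete
  refine .of_bound (hf.comp hY).aestronglyMeasurable C ?_
  filter_upwards [hYs] with ω hω
  exact hC (Set.mem_image_of_mem _ hω)

theorem eventually_eq_iSup_of_monotone {f : ℕ → ℕ} (hf : Monotone f)
    (hbdd : BddAbove (Set.range f)) : ∀ᶠ t in atTop, f t = ⨆ s, f s := by
  obtain ⟨T, hT⟩ := Nat.sSup_mem (Set.range_nonempty f) hbdd
  filter_upwards [eventually_ge_atTop T] with t ht
  exact le_antisymm (le_ciSup hbdd t) (hT.symm.trans_le (hf ht))

variable {f : ℕ → Ω → ℕ}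

theorem ae_eventually_eq_iSup_of_lintegral_le (hf : ∀ t, Measurable (f t))
    (hf_mono : ∀ ω, Monotone fun t => f t ω) {C : ℝ≥0∞} (hC : C ≠ ∞)
    (hfC : ∀ t, ∫⁻ ω, f t ω ∂μ ≤ C) :
    (∀ᵐ ω ∂μ, ∀ᶠ t in atTop, f t ω = ⨆ s, f s ω) ∧ ∫⁻ ω, (⨆ t, f t ω : ℕ) ∂μ ≤ C := by
  have hf_coe (t : ℕ) : Measurable fun ω => (f t ω : ℝ≥0∞) := measurable_from_nat.comp (hf t)
  have hsup_le : ∫⁻ ω, ⨆ t, (f t ω : ℝ≥0∞) ∂μ ≤ C := by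
    rw [lintegral_iSup hf_coe
      fun _ _ hst ω => Nat.cast_le.2 (hf_mono ω hst)]
    exact iSup_le hfC
  have hfin : ∀ᵐ ω ∂μ, ⨆ t, (f t ω : ℝ≥0∞) < ∞ :=
    ae_lt_top (.iSup hf_coe) (ne_top_of_le_ne_top hC hsup_le)
  have hev : ∀ᵐ ω ∂μ, ∀ᶠ t in atTop, f t ω = ⨆ s, f s ω := by
    filter_upwards [hfin] with ω hω
    obtain ⟨n, hn⟩ := ENNReal.exists_nat_gt hω.ne
    refine eventually_eq_iSup_of_monotone (hf_mono ω) ⟨n, Set.forall_mem_range.2 fun t => ?_⟩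
    exact Nat.cast_le.1 ((le_iSup (fun t => (f t ω : ℝ≥0∞)) t).trans hn.le)
  refine ⟨hev, (lintegral_mono_ae ?_).trans hsup_le⟩
  filter_upwards [hev] with ω hω
  obtain ⟨t, ht⟩ := hω.exists
  exact ht ▸ le_iSup (fun t => (f t ω : ℝ≥0∞)) t

end MonotoneSequences

section StableQueue

section

variable {Ω : Type*} {W : ℕ → Ω → ℕ × ℕ}

/-- The length of a queue with input `W` that was empty `t` time slots ago. -/
def backwardQueue (W : ℕ → Ω → ℕ × ℕ) (t : ℕ) (ω : Ω) : ℕ :=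
  backwardOrbit lindleyStep 0 t fun k => W k ω

/-- The length of a queue with input `W` that was empty in the infinite past. The supremum has the
junk value `0` where the backward queue lengths are unbounded, which is a null event for stable
queues. -/
noncomputable def limitQueue (W : ℕ → Ω → ℕ × ℕ) (ω : Ω) : ℕ := ⨆ t, backwardQueue W t ω

theorem backwardQueue_succ (t : ℕ) (ω : Ω) :
    backwardQueue W (t + 1) ω = lindleyStep (backwardQueue (fun k => W (k + 1)) t ω) (W 0 ω) :=
  backwardOrbit_succ 0 t

theorem monotone_backwardQueue (ω : Ω) : Monotone fun t => backwardQueue W t ω :=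
  monotone_backwardOrbit monotone_lindleyStep fun _ => Nat.zero_le _

end

variable {Ω : Type*} [MeasurableSpace Ω] {μ : Measure Ω} {W : ℕ → Ω → ℕ × ℕ}

theorem IsIID.tendsto_sum_atBot {Y : ℕ → Ω → ℝ} (hY : IsIID μ Y) (hY_int : Integrable (Y 0) μ)
    (hY_neg : ∫ ω, Y 0 ω ∂μ < 0) :
    ∀ᵐ ω ∂μ, Tendsto (fun t => ∑ k ∈ Finset.range t, Y k ω) atTop atBot := by
  have hSLLN := strong_law_ae_real Y hY_int (fun _ _ hjk => hY.indep.indepFun hjk) hY.ident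
  filter_upwards [hSLLN] with ω hω
  refine (hω.neg_mul_atTop hY_neg tendsto_natCast_atTop_atTop).congr' ?_
  filter_upwards [eventually_ne_atTop 0] with t ht
  exact div_mul_cancel₀ _ (Nat.cast_ne_zero.2 ht)

theorem IsIID.measurable_backwardQueue (hW : IsIID μ W) (t : ℕ) : Measurable (backwardQueue W t) :=
  (measurable_backwardOrbit .of_discrete 0 t).comp hW.measurable_process

theorem IsIID.measurable_limitQueue (hW : IsIID μ W) : Measurable (limitQueue W) :=
  .iSup hW.measurable_backwardQueue

theorem IsIID.identDistrib_backwardQueue_shift (hW : IsIID μ W) (t : ℕ) :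
    IdentDistrib (backwardQueue (fun k => W (k + 1)) t) (backwardQueue W t) μ μ :=
  (hW.identDistrib_reindex (add_left_injective 1)).comp (measurable_backwardOrbit .of_discrete 0 t)

/-- `W t = (a t, s t)` are the inputs of a stable single-server queue with independent and
identically distributed time slots: the arrivals `a t` are bounded, at most one customer is served
per time slot, and the load is less than one. -/
structure IsStableQueueInput (μ : Measure Ω) (W : ℕ → Ω → ℕ × ℕ) : Prop extends IsIID μ W where
  bounded_arrival : ∃ K, ∀ᵐ ω ∂μ, (W 0 ω).1 ≤ K
  service_le_one : ∀ᵐ ω ∂μ, (W 0 ω).2 ≤ 1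
  netInput_neg : ∫ ω, netInput (W 0 ω) ∂μ < 0

namespace IsStableQueueInput

theorem ae_arrival_le (h : IsStableQueueInput μ W) : ∃ K, ∀ᵐ ω ∂μ, ∀ t, (W t ω).1 ≤ K := by
  obtain ⟨K, hK⟩ := h.bounded_arrival
  exact ⟨K, h.ae_all (p := fun v => v.1 ≤ K) .of_discrete hK⟩

theorem integrable_comp_input (h : IsStableQueueInput μ W) (f : ℕ × ℕ → ℝ) :
    Integrable (fun ω => f (W 0 ω)) μ := by
  have := h.indep.isProbabilityMeasure
  obtain ⟨K, hK⟩ := h.bounded_arrival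
  refine integrable_comp_of_ae_mem_finite (h.measurable 0) (Set.finite_Iic (K, 1)) ?_ f
  filter_upwards [hK, h.service_le_one] with ω hKω hsω using ⟨hKω, hsω⟩

theorem ae_eventually_orbit_eq (h : IsStableQueueInput μ W) :
    ∀ᵐ ω ∂μ, ∀ x, ∀ᶠ t in atTop,
      drivenOrbit lindleyStep x (fun k => W k ω) t = drivenOrbit lindleyStep 0 (fun k => W k ω) t ∧
      backwardOrbit lindleyStep x t (fun k => W k ω)
        = backwardOrbit lindleyStep 0 t fun k => W k ω := by
  filter_upwards [(h.comp (f := netInput) .of_discrete).tendsto_sum_atBot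
    (h.integrable_comp_input netInput) h.netInput_neg] with ω hω
  exact eventually_lindleyStep_orbit_eq hω

theorem exists_ae_backwardQueue_le (h : IsStableQueueInput μ W) :
    ∃ K : ℕ, ∀ᵐ ω ∂μ, ∀ t, backwardQueue W t ω ≤ K * t := by
  obtain ⟨K, hK⟩ := h.ae_arrival_le
  exact ⟨K, hK.mono fun ω hω t => backwardOrbit_lindleyStep_le hω t⟩

theorem integrable_comp_backwardQueue (h : IsStableQueueInput μ W) (t : ℕ) (f : ℕ → ℝ) :
    Integrable (fun ω => f (backwardQueue W t ω)) μ := by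
  have := h.indep.isProbabilityMeasure
  obtain ⟨K, hK⟩ := h.exists_ae_backwardQueue_le
  exact integrable_comp_of_ae_mem_finite (h.measurable_backwardQueue t) (Set.finite_Iic (K * t))
    (hK.mono fun _ hω => hω t) f

theorem integral_queuePotential_succ (h : IsStableQueueInput μ W) (t : ℕ) :
    ∫ ω, queuePotential (backwardQueue W (t + 1) ω) ∂μ
      = ∫ ω, queuePotential (backwardQueue W t ω) ∂μ
        + 2 * ((∫ ω, (backwardQueue W t ω : ℝ) ∂μ) * ∫ ω, netInput (W 0 ω) ∂μ)
        + (∫ ω, netInput (W 0 ω) ^ 2 ∂μ + ∫ ω, netInput (W 0 ω) ∂μ) := by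
  have hshift := h.identDistrib_backwardQueue_shift t
  have hcomp (f : ℕ → ℝ) : IdentDistrib (fun ω => f (backwardQueue (fun k => W (k + 1)) t ω))
      (fun ω => f (backwardQueue W t ω)) μ μ := hshift.comp .of_discrete
  have hint (f : ℕ → ℝ) : Integrable (fun ω => f (backwardQueue (fun k => W (k + 1)) t ω)) μ :=
    (hcomp f).integrable_iff.2 (h.integrable_comp_backwardQueue t f)
  have hmeas : Measurable fun w : ℕ → ℕ × ℕ => ((backwardOrbit lindleyStep 0 t w : ℕ) : ℝ) :=
    measurable_from_nat.comp (measurable_backwardOrbit .of_discrete 0 t)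
  have hindep : IndepFun (fun ω => (backwardQueue (fun k => W (k + 1)) t ω : ℝ))
      (fun ω => netInput (W 0 ω)) μ :=
    h.indepFun_shift.comp hmeas (.of_discrete (f := netInput))
  have hnet := h.integrable_comp_input netInput
  have hnet_sq := h.integrable_comp_input fun v => netInput v ^ 2
  have hmul : Integrable (fun ω => (backwardQueue (fun k => W (k + 1)) t ω : ℝ)
      * netInput (W 0 ω)) μ := hindep.integrable_mul (hint Nat.cast) hnet
  have hstep : ∀ᵐ ω ∂μ, queuePotential (backwardQueue W (t + 1) ω) =
      queuePotential (backwardQueue (fun k => W (k + 1)) t ω)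
        + 2 * (backwardQueue (fun k => W (k + 1)) t ω * netInput (W 0 ω))
        + (netInput (W 0 ω) ^ 2 + netInput (W 0 ω)) := by
    filter_upwards [h.service_le_one] with ω hω
    rw [backwardQueue_succ, queuePotential_lindleyStep _ hω]
  have hdrift : Integrable (fun ω => queuePotential (backwardQueue (fun k => W (k + 1)) t ω)
      + 2 * (backwardQueue (fun k => W (k + 1)) t ω * netInput (W 0 ω))) μ :=
    (hint queuePotential).add (hmul.const_mul 2)
  have hnoise : Integrable (fun ω => netInput (W 0 ω) ^ 2 + netInput (W 0 ω)) μ :=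
    hnet_sq.add hnet
  rw [integral_congr_ae hstep, integral_add hdrift hnoise,
    integral_add (hint queuePotential) (hmul.const_mul 2), integral_add hnet_sq hnet,
    integral_const_mul,
    hindep.integral_fun_mul_eq_mul_integral (hint Nat.cast).aestronglyMeasurable
      hnet.aestronglyMeasurable, (hcomp queuePotential).integral_eq, (hcomp Nat.cast).integral_eq]

theorem integral_queuePotential (h : IsStableQueueInput μ W) (t : ℕ) :
    ∫ ω, queuePotential (backwardQueue W t ω) ∂μ
      = 2 * (∑ k ∈ Finset.range t, ∫ ω, (backwardQueue W k ω : ℝ) ∂μ)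
          * ∫ ω, netInput (W 0 ω) ∂μ
        + t * (∫ ω, netInput (W 0 ω) ^ 2 ∂μ + ∫ ω, netInput (W 0 ω) ∂μ) := by
  induction t with
  | zero => simp [backwardQueue, backwardOrbit, drivenOrbit, queuePotential]
  | succ t ih =>
    rw [h.integral_queuePotential_succ, ih, Finset.sum_range_succ]
    push_cast
    ring

theorem exists_integral_backwardQueue_le (h : IsStableQueueInput μ W) :
    ∃ C, ∀ t, ∫ ω, (backwardQueue W t ω : ℝ) ∂μ ≤ C := by
  set m := ∫ ω, netInput (W 0 ω) ∂μ
  refine ⟨_, le_two_mul_of_sum_range_le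
    (C := (∫ ω, netInput (W 0 ω) ^ 2 ∂μ + m) / (-2 * m)) (fun s t hst => ?_)
    (fun t => integral_nonneg fun ω => Nat.cast_nonneg _) fun t => ?_⟩
  · exact integral_mono (h.integrable_comp_backwardQueue s Nat.cast)
      (h.integrable_comp_backwardQueue t Nat.cast) fun ω =>
      Nat.cast_le.2 (monotone_backwardQueue ω hst)
  · have hm : 0 < -2 * m := by linarith [h.netInput_neg]
    rw [div_mul_eq_mul_div, le_div_iff₀ hm]
    have hpot : 0 ≤ ∫ ω, queuePotential (backwardQueue W t ω) ∂μ :=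
      integral_nonneg fun ω => by unfold queuePotential; positivity
    rw [h.integral_queuePotential] at hpot
    linarith

theorem ae_eventually_backwardQueue_eq_and_integrable (h : IsStableQueueInput μ W) :
    (∀ᵐ ω ∂μ, ∀ᶠ t in atTop, backwardQueue W t ω = limitQueue W ω) ∧
      Integrable (fun ω => (limitQueue W ω : ℝ)) μ := by
  obtain ⟨C, hC⟩ := h.exists_integral_backwardQueue_le
  have hlint (t : ℕ) : ∫⁻ ω, backwardQueue W t ω ∂μ ≤ ENNReal.ofReal C := by
    refine le_trans (le_of_eq ?_) (ENNReal.ofReal_le_ofReal (hC t))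
    rw [ofReal_integral_eq_lintegral_ofReal (h.integrable_comp_backwardQueue t Nat.cast)
      (ae_of_all _ fun ω => Nat.cast_nonneg _)]
    simp only [ENNReal.ofReal_natCast]
  obtain ⟨hev, hle⟩ := ae_eventually_eq_iSup_of_lintegral_le h.measurable_backwardQueue
    monotone_backwardQueue ENNReal.ofReal_ne_top hlint
  refine ⟨hev, (measurable_from_nat.comp h.measurable_limitQueue).aestronglyMeasurable, ?_⟩
  simp only [HasFiniteIntegral, Real.enorm_natCast]
  exact hle.trans_lt ENNReal.ofReal_lt_top

theorem ae_eventually_backwardQueue_eq (h : IsStableQueueInput μ W) :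
    ∀ᵐ ω ∂μ, ∀ᶠ t in atTop, backwardQueue W t ω = limitQueue W ω :=
  h.ae_eventually_backwardQueue_eq_and_integrable.1

theorem integrable_limitQueue (h : IsStableQueueInput μ W) :
    Integrable (fun ω => (limitQueue W ω : ℝ)) μ :=
  h.ae_eventually_backwardQueue_eq_and_integrable.2

theorem ae_backwardQueue_le_limitQueue (h : IsStableQueueInput μ W) :
    ∀ᵐ ω ∂μ, ∀ t, backwardQueue W t ω ≤ limitQueue W ω := by
  filter_upwards [h.ae_eventually_backwardQueue_eq] with ω hω t
  obtain ⟨s, hs, hts⟩ := (hω.and (eventually_ge_atTop t)).exists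
  exact (monotone_backwardQueue ω hts).trans_eq hs

theorem tendsto_integral_backwardQueue (h : IsStableQueueInput μ W) :
    Tendsto (fun t => ∫ ω, (backwardQueue W t ω : ℝ) ∂μ) atTop
      (𝓝 (∫ ω, (limitQueue W ω : ℝ) ∂μ)) := by
  refine tendsto_integral_of_dominated_convergence (fun ω => (limitQueue W ω : ℝ))
    (fun t => (h.integrable_comp_backwardQueue t Nat.cast).aestronglyMeasurable)
    h.integrable_limitQueue (fun t => ?_) ?_
  · filter_upwards [h.ae_backwardQueue_le_limitQueue] with ω hω
    simpa only [Real.norm_natCast] using Nat.cast_le.2 (hω t)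
  · filter_upwards [h.ae_eventually_backwardQueue_eq] with ω hω
    exact tendsto_const_nhds.congr' (hω.mono fun t ht => congrArg Nat.cast ht.symm)

/-- A second moment of the limit need not be known to be finite here: the potential grows at most
linearly in `t` on the bounded range of the arrivals, so that `t⁻¹ • queuePotential` is dominated
by a multiple of the limit. -/
theorem tendsto_integral_queuePotential_div (h : IsStableQueueInput μ W) :
    Tendsto (fun t : ℕ => (∫ ω, queuePotential (backwardQueue W t ω) ∂μ) / t) atTop (𝓝 0) := by
  obtain ⟨K, hK⟩ := h.exists_ae_backwardQueue_le
  have := h.indep.isProbabilityMeasure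
  simp only [← integral_div]
  rw [← integral_zero Ω ℝ (μ := μ)]
  refine tendsto_integral_of_dominated_convergence (fun ω => K * ((limitQueue W ω : ℝ) + 1))
    (fun t => ((h.integrable_comp_backwardQueue t queuePotential).div_const _).aestronglyMeasurable)
    ((h.integrable_limitQueue.add (integrable_const 1)).const_mul _) (fun t => ?_) ?_
  · filter_upwards [hK, h.ae_backwardQueue_le_limitQueue] with ω hKω hω
    have hKt : (backwardQueue W t ω : ℝ) ≤ K * t := by exact_mod_cast hKω t
    have hle : (backwardQueue W t ω : ℝ) ≤ limitQueue W ω := Nat.cast_le.2 (hω t)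
    rw [queuePotential, Real.norm_of_nonneg (by positivity)]
    refine div_le_of_le_mul₀ (Nat.cast_nonneg _) (by positivity) ?_
    calc (backwardQueue W t ω : ℝ) * (backwardQueue W t ω + 1)
        ≤ K * t * (limitQueue W ω + 1) := by gcongr
      _ = K * (limitQueue W ω + 1) * t := by ring
  · filter_upwards [h.ae_eventually_backwardQueue_eq] with ω hω
    refine (tendsto_const_div_atTop_nhds_zero_nat (queuePotential (limitQueue W ω))).congr' ?_
    filter_upwards [hω] with t ht
    rw [ht]

theorem integral_limitQueue (h : IsStableQueueInput μ W) :
    ∫ ω, (limitQueue W ω : ℝ) ∂μ = (∫ ω, netInput (W 0 ω) ^ 2 ∂μ + ∫ ω, netInput (W 0 ω) ∂μ)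
      / (-2 * ∫ ω, netInput (W 0 ω) ∂μ) := by
  set m := ∫ ω, netInput (W 0 ω) ∂μ
  set v := ∫ ω, netInput (W 0 ω) ^ 2 ∂μ
  have hm : -2 * m ≠ 0 := by linarith [h.netInput_neg]
  have hmean := h.tendsto_integral_backwardQueue.cesaro
  have hbalance : Tendsto (fun t : ℕ => (∫ ω, queuePotential (backwardQueue W t ω) ∂μ) / t) atTop
      (𝓝 (2 * (∫ ω, (limitQueue W ω : ℝ) ∂μ) * m + (v + m))) := by
    refine (((hmean.const_mul 2).mul_const m).add_const (v + m)).congr' ?_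
    filter_upwards [eventually_ne_atTop 0] with t ht
    rw [h.integral_queuePotential, add_div, mul_div_cancel_left₀ _ (Nat.cast_ne_zero.2 ht)]
    ring
  rw [eq_div_iff hm]
  linarith [tendsto_nhds_unique h.tendsto_integral_queuePotential_div hbalance]

end IsStableQueueInput

end StableQueue

section Schedules

theorem map_eq_sum_smul_dirac {Ω S κ : Type*} [MeasurableSpace Ω] {μ : Measure Ω}
    [IsFiniteMeasure μ] [MeasurableSpace S] [MeasurableSingletonClass S] [Fintype κ] {Y : Ω → S}
    (hY : Measurable Y) {f : κ → S} (hf : f.Injective)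
    (hYf : ∑ k, μ {ω | Y ω = f k} = μ Set.univ) :
    μ.map Y = ∑ k, μ {ω | Y ω = f k} • Measure.dirac (f k) := by
  classical
  symm
  have : IsFiniteMeasure (∑ k, μ {ω | Y ω = f k} • Measure.dirac (f k)) :=
    ⟨by simp [hYf]⟩
  refine Measure.eq_of_le_of_measure_univ_eq (Measure.le_iff.2 fun A hA => ?_) ?_
  · have hmeas (k : κ) : MeasurableSet {ω | Y ω = f k} := hY (measurableSet_singleton _)
    calc (∑ k, μ {ω | Y ω = f k} • Measure.dirac (f k)) A
        = ∑ k with f k ∈ A, μ {ω | Y ω = f k} := by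
          simp [hA, Set.indicator_apply, Finset.sum_filter]
      _ = μ (⋃ k ∈ ({k | f k ∈ A} : Finset κ), {ω | Y ω = f k}) := by
          refine (measure_biUnion_finset (fun k _ l _ hkl => ?_) fun k _ => hmeas k).symm
          exact Set.disjoint_left.2 fun ω hk hl => hkl (hf (hk.symm.trans hl))
      _ ≤ μ (Y ⁻¹' A) := by
          refine measure_mono (Set.iUnion₂_subset fun k hk ω (hω : Y ω = f k) => ?_)
          simpa [hω] using hk
      _ = μ.map Y A := (Measure.map_apply hY hA).symm
  · simp [hYf, Measure.map_apply hY]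

variable {n : ℕ}

theorem permSchedule_eq_one_iff {p : Equiv.Perm (Fin n)} {i j : Fin n} :
    permSchedule p i j = 1 ↔ p i = j := by
  simp [permSchedule]

theorem permSchedule_eq_zero_or_one (p : Equiv.Perm (Fin n)) (i j : Fin n) :
    permSchedule p i j = 0 ∨ permSchedule p i j = 1 := by
  unfold permSchedule
  split_ifs <;> simp

theorem permSchedule_injective : Function.Injective (permSchedule (n := n)) := fun p _ h =>
  Equiv.ext fun i => (permSchedule_eq_one_iff.1 <|
    (congrFun₂ h i (p i)).symm.trans (permSchedule_eq_one_iff.2 rfl)).symm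

/-- By symmetry the sum does not depend on `j`, and each permutation matrix has row sum `1`. -/
theorem sum_permSchedule (i j : Fin n) :
    ∑ p : Equiv.Perm (Fin n), (permSchedule p i j : ℝ) = n.factorial / n := by
  have hsymm (j' : Fin n) : ∑ p : Equiv.Perm (Fin n), (permSchedule p i j' : ℝ)
      = ∑ p : Equiv.Perm (Fin n), (permSchedule p i j : ℝ) := by
    refine Fintype.sum_equiv (Equiv.mulLeft (Equiv.swap j' j)) _ _ fun p => ?_
    simp only [permSchedule, Equiv.coe_mulLeft, Equiv.Perm.coe_mul, Function.comp_apply,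
      Equiv.swap_apply_eq_iff, Equiv.swap_apply_right]
  have hrow : ∑ j' : Fin n, ∑ p : Equiv.Perm (Fin n), (permSchedule p i j' : ℝ) = n.factorial := by
    rw [Finset.sum_comm]
    simp [permSchedule, Fintype.card_perm]
  rw [Finset.sum_congr rfl fun j' _ => hsymm j'] at hrow
  rw [eq_div_iff (Nat.cast_ne_zero.2 i.pos.ne'), ← hrow]
  simp [mul_comm]

end Schedules

section SwitchDynamics

variable {n : ℕ}

/-- One time slot of the switch, as a recursion driven by the pairs of arrivals and schedules. -/
def switchStep (x : SwitchMat n) (v : SwitchMat n × SwitchMat n) : SwitchMat n :=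
  queueStep x v.1 v.2

/-- The queue lengths of a switch that was empty in the infinite past, with the inputs listed
backwards in time. Each entry is a `limitQueue`, and has its junk value `0` where the backward queue
lengths are unbounded. -/
noncomputable def limitSwitch (w : ℕ → SwitchMat n × SwitchMat n) : SwitchMat n :=
  fun i j => ⨆ t, backwardOrbit switchStep 0 t w i j

variable {w : ℕ → SwitchMat n × SwitchMat n}

theorem drivenOrbit_switchStep_apply (x : SwitchMat n) (t : ℕ) (i j : Fin n) :
    drivenOrbit switchStep x w t i j =
      drivenOrbit lindleyStep (x i j) (fun k => ((w k).1 i j, (w k).2 i j)) t :=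
  map_drivenOrbit (φ := fun y : SwitchMat n => y i j)
    (ψ := fun v : SwitchMat n × SwitchMat n => (v.1 i j, v.2 i j)) (fun _ _ => rfl) x t

theorem backwardOrbit_switchStep_apply (x : SwitchMat n) (t : ℕ) (i j : Fin n) :
    backwardOrbit switchStep x t w i j =
      backwardOrbit lindleyStep (x i j) t fun k => ((w k).1 i j, (w k).2 i j) :=
  drivenOrbit_switchStep_apply x t i j

theorem measurable_limitSwitch : Measurable (limitSwitch (n := n)) :=
  measurable_pi_lambda _ fun i => measurable_pi_lambda _ fun j => .iSup fun t =>
    (Measurable.of_discrete (f := fun y : SwitchMat n => y i j)).comp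
      (measurable_backwardOrbit .of_discrete 0 t)

theorem limitSwitch_apply {Ω : Type*} (a s : ℕ → Ω → SwitchMat n) (ω : Ω) (i j : Fin n) :
    limitSwitch (fun k => (a k ω, s k ω)) i j = limitQueue (fun t ω => (a t ω i j, s t ω i j)) ω :=
  iSup_congr fun t => backwardOrbit_switchStep_apply 0 t i j

end SwitchDynamics

theorem variance_eq_of_ae_eq_zero_or_one {Ω : Type*} [MeasurableSpace Ω] {μ : Measure Ω}
    [IsProbabilityMeasure μ] {Y : Ω → ℝ} (hY : AEMeasurable Y μ)
    (hY01 : ∀ᵐ ω ∂μ, Y ω = 0 ∨ Y ω = 1) :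
    variance Y μ = (∫ ω, Y ω ∂μ) * (1 - ∫ ω, Y ω ∂μ) := by
  have hint : Integrable Y μ := .of_bound hY.aestronglyMeasurable 1 <| by
    filter_upwards [hY01] with ω hω
    rcases hω with hω | hω <;> simp [hω]
  rw [variance_of_ae_eq_zero_or_one hY hY01, ← integral_of_ae_eq_zero_or_one hY hY01,
    ← integral_one_sub_of_ae_eq_zero_or_one hY hY01, integral_sub (integrable_const 1) hint]
  simp [mul_comm]

theorem tendstoInDistribution_id_of_eq_map {ι Ω E : Type*} {Ω' : ι → Type*} [MeasurableSpace Ω]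
    [∀ i, MeasurableSpace (Ω' i)] {μ : Measure Ω} [IsProbabilityMeasure μ]
    {ν : ∀ i, Measure (Ω' i)} [∀ i, IsProbabilityMeasure (ν i)] [TopologicalSpace E]
    [MeasurableSpace E] [OpensMeasurableSpace E] {X : ∀ i, Ω' i → E} {l : Filter ι} {Z : Ω → E}
    (h : TendstoInDistribution X l Z ν μ) {π : ProbabilityMeasure E}
    (hπ : (π : Measure E) = μ.map Z) : TendstoInDistribution X l id ν (π : Measure E) := by
  refine ⟨h.forall_aemeasurable, aemeasurable_id, ?_⟩
  convert h.tendsto using 2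
  exact congrArg 𝓝 (Subtype.ext (Measure.map_id.trans hπ))

namespace IsRandomSwitch

variable {n : ℕ} {Ω : Type*} [MeasurableSpace Ω] {μ : Measure Ω} {ε : ℝ}
  {a s q : ℕ → Ω → SwitchMat n}

theorem isIID_arrival (h : IsRandomSwitch μ ε a s q) : IsIID μ a := by
  have hmeas (t : ℕ) (p : Fin n × Fin n) : Measurable fun ω => a t ω p.1 p.2 :=
    (Measurable.of_discrete (f := fun x : SwitchMat n => x p.1 p.2)).comp (h.measurable_arrival t)
  have hindep (t : ℕ) : iIndepFun (fun (p : Fin n × Fin n) ω => a t ω p.1 p.2) μ :=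
    h.indep_arrival.precomp (g := fun p : Fin n × Fin n => (t, p)) (Prod.mk_right_injective t)
  have huncurried : IsIID μ fun t ω (p : Fin n × Fin n) => a t ω p.1 p.2 :=
    { measurable := fun t => measurable_pi_lambda _ (hmeas t)
      indep := iIndepFun_curry hmeas h.indep_arrival
      ident := fun t => .pi (fun p => h.ident_arrival t p.1 p.2) (hindep t) (hindep 0) }
  exact huncurried.comp (f := Function.curry) .of_discrete

theorem sum_measure_schedule_eq (h : IsRandomSwitch μ ε a s q) (t : ℕ) :
    ∑ p, μ {ω | s t ω = permSchedule p} = 1 := by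
  simp only [h.uniform_schedule, Finset.sum_const, Finset.card_univ, Fintype.card_perm,
    Fintype.card_fin, nsmul_eq_mul]
  exact ENNReal.mul_inv_cancel (Nat.cast_ne_zero.2 n.factorial_ne_zero) (ENNReal.natCast_ne_top _)

theorem indepFun_arrival_schedule (h : IsRandomSwitch μ ε a s q) (t : ℕ) :
    IndepFun (a t) (s t) μ :=
  h.indep_arrival_schedule.comp (measurable_pi_apply t) (measurable_pi_apply t)

theorem indepFun_init_input (h : IsRandomSwitch μ ε a s q) :
    IndepFun (q 0) (fun ω t => (a t ω, s t ω)) μ :=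
  h.indep_init.comp (ψ := fun (p : (ℕ → SwitchMat n) × (ℕ → SwitchMat n)) t => (p.1 t, p.2 t))
    measurable_id (by fun_prop)

theorem queueTransition_pos (h : IsRandomSwitch μ ε a s q) (x : SwitchMat n)
    (p : Equiv.Perm (Fin n)) : 0 < queueTransition μ a s x (queueStep x 0 (permSchedule p)) := by
  have hs : μ (s 0 ⁻¹' {permSchedule p}) ≠ 0 :=
    (h.uniform_schedule 0 p).trans_ne (ENNReal.inv_ne_zero.2 (ENNReal.natCast_ne_top _))
  calc 0 < μ (a 0 ⁻¹' {0}) * μ (s 0 ⁻¹' {permSchedule p}) :=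
        ENNReal.mul_pos (h.no_arrival 0).ne' hs
    _ = μ (a 0 ⁻¹' {0} ∩ s 0 ⁻¹' {permSchedule p}) :=
        ((h.indepFun_arrival_schedule 0).measure_inter_preimage_eq_mul _ _
          (measurableSet_singleton _) (measurableSet_singleton _)).symm
    _ ≤ queueTransition μ a s x (queueStep x 0 (permSchedule p)) :=
        measure_mono fun ω ⟨haω, hsω⟩ => congrArg₂ (queueStep x) haω hsω

theorem queueTransition_zero_pos (h : IsRandomSwitch μ ε a s q) :
    0 < queueTransition μ a s 0 0 := by
  have hzero : queueStep (0 : SwitchMat n) 0 (permSchedule 1) = 0 := by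
    ext i j
    simp [queueStep]
  have hpos := h.queueTransition_pos 0 1
  rwa [hzero] at hpos

/-- Without arrivals, any nonempty queue can be served, so the total queue length can be
decreased until the switch is empty. -/
theorem zero_mem_reachableFrom (h : IsRandomSwitch μ ε a s q) (x : SwitchMat n) :
    0 ∈ reachableFrom (queueTransition μ a s) x := by
  induction hN : ∑ i, ∑ j, x i j using Nat.strong_induction_on generalizing x with
  | _ N ih =>
    by_cases hx : x = 0
    · rw [hx]
      exact mem_reachableFrom_self 0
    · obtain ⟨i, j, hij⟩ : ∃ i j, x i j ≠ 0 := by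
        by_contra! hzero
        exact hx (funext₂ hzero)
      refine mem_reachableFrom_trans
        (mem_reachableFrom_of_pos (h.queueTransition_pos x (Equiv.swap i j))) (ih _ ?_ _ rfl)
      have hle (i' j' : Fin n) :
          queueStep x 0 (permSchedule (Equiv.swap i j)) i' j' ≤ x i' j' := Nat.sub_le _ _
      have hlt : queueStep x 0 (permSchedule (Equiv.swap i j)) i j < x i j := by
        simp only [queueStep, permSchedule, Equiv.swap_apply_left, if_true]
        exact Nat.sub_lt (Nat.pos_of_ne_zero hij) one_pos
      rw [← hN]
      exact Finset.sum_lt_sum (fun i' _ => Finset.sum_le_sum fun j' _ => hle i' j')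
        ⟨i, Finset.mem_univ _, Finset.sum_lt_sum (fun j' _ => hle i j') ⟨j, Finset.mem_univ _, hlt⟩⟩

variable [IsProbabilityMeasure μ]

theorem map_schedule (h : IsRandomSwitch μ ε a s q) (t : ℕ) :
    μ.map (s t) = ∑ p : Equiv.Perm (Fin n),
      ((n.factorial : ℕ) : ℝ≥0∞)⁻¹ • Measure.dirac (permSchedule p) := by
  rw [map_eq_sum_smul_dirac (h.measurable_schedule t) permSchedule_injective
    ((h.sum_measure_schedule_eq t).trans measure_univ.symm)]
  simp only [h.uniform_schedule]

theorem ae_schedule_eq_zero_or_one (h : IsRandomSwitch μ ε a s q) (t : ℕ) (i j : Fin n) :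
    ∀ᵐ ω ∂μ, s t ω i j = 0 ∨ s t ω i j = 1 := by
  have hlaw : ∀ᵐ x ∂μ.map (s t), x i j = 0 ∨ x i j = 1 := by
    rw [h.map_schedule, ae_iff]
    simp [permSchedule_eq_zero_or_one, -not_or]
  exact ae_of_ae_map (h.measurable_schedule t).aemeasurable hlaw

theorem integral_schedule (h : IsRandomSwitch μ ε a s q) (t : ℕ) (i j : Fin n) :
    ∫ ω, (s t ω i j : ℝ) ∂μ = 1 / n := by
  have hfac : (n.factorial : ℝ) ≠ 0 := Nat.cast_ne_zero.2 n.factorial_ne_zero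
  have hint (p : Equiv.Perm (Fin n)) : Integrable (fun x : SwitchMat n => (x i j : ℝ))
      (((n.factorial : ℕ) : ℝ≥0∞)⁻¹ • Measure.dirac (permSchedule p)) :=
    (integrable_dirac enorm_lt_top).smul_measure
      (ENNReal.inv_ne_top.2 (Nat.cast_ne_zero.2 n.factorial_ne_zero))
  have hcoord : Measurable fun x : SwitchMat n => (x i j : ℝ) := .of_discrete
  calc ∫ ω, (s t ω i j : ℝ) ∂μ = ∫ x, (x i j : ℝ) ∂μ.map (s t) :=
        (integral_map (h.measurable_schedule t).aemeasurable hcoord.aestronglyMeasurable).symm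
    _ = ∑ p : Equiv.Perm (Fin n), (n.factorial : ℝ)⁻¹ * permSchedule p i j := by
        rw [h.map_schedule, integral_finsetSum_measure fun p _ => hint p]
        simp
    _ = 1 / n := by
        rw [← Finset.mul_sum, sum_permSchedule]
        field_simp

theorem isIID_schedule (h : IsRandomSwitch μ ε a s q) : IsIID μ s where
  measurable := h.measurable_schedule
  indep := h.indep_schedule
  ident t := ⟨(h.measurable_schedule t).aemeasurable, (h.measurable_schedule 0).aemeasurable,
    (h.map_schedule t).trans (h.map_schedule 0).symm⟩

theorem isIID_input (h : IsRandomSwitch μ ε a s q) : IsIID μ fun t ω => (a t ω, s t ω) :=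
  h.isIID_arrival.prodMk h.isIID_schedule h.indep_arrival_schedule

theorem memLp_arrival (h : IsRandomSwitch μ ε a s q) (t : ℕ) (i j : Fin n) :
    MemLp (fun ω => (a t ω i j : ℝ)) 2 μ := by
  obtain ⟨K, hK⟩ := h.bounded_arrival
  have hmeas := (Measurable.of_discrete (f := fun x : SwitchMat n => (x i j : ℝ))).comp
    (h.measurable_arrival t)
  refine .of_bound hmeas.aestronglyMeasurable K ?_
  filter_upwards [hK t i j] with ω hω
  simpa using hω

theorem memLp_schedule (h : IsRandomSwitch μ ε a s q) (t : ℕ) (i j : Fin n) :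
    MemLp (fun ω => (s t ω i j : ℝ)) 2 μ := by
  have hmeas := (Measurable.of_discrete (f := fun x : SwitchMat n => (x i j : ℝ))).comp
    (h.measurable_schedule t)
  refine .of_bound hmeas.aestronglyMeasurable 1 ?_
  filter_upwards [h.ae_schedule_eq_zero_or_one t i j] with ω hω
  rcases hω with hω | hω <;> simp [hω]

theorem integral_netInput (h : IsRandomSwitch μ ε a s q) (t : ℕ) (i j : Fin n) :
    ∫ ω, netInput (a t ω i j, s t ω i j) ∂μ = -(ε / n) := by
  simp only [netInput]
  rw [integral_sub ((h.memLp_arrival t i j).integrable one_le_two)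
    ((h.memLp_schedule t i j).integrable one_le_two), h.mean_arrival, h.integral_schedule]
  ring

theorem variance_schedule (h : IsRandomSwitch μ ε a s q) (t : ℕ) (i j : Fin n) :
    variance (fun ω => (s t ω i j : ℝ)) μ = 1 / n * (1 - 1 / n) := by
  rw [variance_eq_of_ae_eq_zero_or_one (h.memLp_schedule t i j).aemeasurable
    (by exact_mod_cast h.ae_schedule_eq_zero_or_one t i j), h.integral_schedule]

theorem variance_arrival_of_ae_eq_zero_or_one (h : IsRandomSwitch μ ε a s q) {t : ℕ} {i j : Fin n}
    (ha : ∀ᵐ ω ∂μ, a t ω i j = 0 ∨ a t ω i j = 1) :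
    variance (fun ω => (a t ω i j : ℝ)) μ = (1 - ε) / n * (1 - (1 - ε) / n) := by
  rw [variance_eq_of_ae_eq_zero_or_one (h.memLp_arrival t i j).aemeasurable
    (by exact_mod_cast ha), h.mean_arrival]

theorem integral_netInput_sq (h : IsRandomSwitch μ ε a s q) (t : ℕ) (i j : Fin n) :
    ∫ ω, netInput (a t ω i j, s t ω i j) ^ 2 ∂μ
      = variance (fun ω => (a t ω i j : ℝ)) μ + 1 / n * (1 - 1 / n) + (ε / n) ^ 2 := by
  have hindep : IndepFun (fun ω => (a t ω i j : ℝ)) (fun ω => (s t ω i j : ℝ)) μ :=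
    (h.indepFun_arrival_schedule t).comp (.of_discrete (f := fun x : SwitchMat n => (x i j : ℝ)))
      (.of_discrete (f := fun x : SwitchMat n => (x i j : ℝ)))
  have hvar := variance_eq_sub ((h.memLp_arrival t i j).sub (h.memLp_schedule t i j))
  rw [variance_sub (h.memLp_arrival t i j) (h.memLp_schedule t i j),
    hindep.covariance_eq_zero (h.memLp_arrival t i j) (h.memLp_schedule t i j),
    h.variance_schedule] at hvar
  have hmean := h.integral_netInput t i j
  simp only [netInput, Pi.sub_apply, Pi.pow_apply] at hvar hmean ⊢
  rw [hmean] at hvar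
  linarith

theorem isStableQueueInput (h : IsRandomSwitch μ ε a s q) (hε : 0 < ε) (i j : Fin n) :
    IsStableQueueInput μ fun t ω => (a t ω i j, s t ω i j) where
  toIsIID := h.isIID_input.comp
    (f := fun v : SwitchMat n × SwitchMat n => (v.1 i j, v.2 i j)) .of_discrete
  bounded_arrival := h.bounded_arrival.imp fun _ hK => hK 0 i j
  service_le_one := (h.ae_schedule_eq_zero_or_one 0 i j).mono fun _ hω => by omega
  netInput_neg := by
    have hn : (0 : ℝ) < n := Nat.cast_pos.2 i.pos
    rw [h.integral_netInput]
    exact neg_neg_of_pos (by positivity)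

theorem ae_eventually_drivenOrbit_eq (h : IsRandomSwitch μ ε a s q) (hε : 0 < ε) :
    ∀ᵐ ω ∂μ, ∀ x, ∀ᶠ t in atTop, drivenOrbit switchStep x (fun k => (a k ω, s k ω)) t
      = drivenOrbit switchStep 0 (fun k => (a k ω, s k ω)) t := by
  filter_upwards [ae_all_iff.2 fun i => ae_all_iff.2 fun j =>
    (h.isStableQueueInput hε i j).ae_eventually_orbit_eq] with ω hω x
  filter_upwards [eventually_all.2 fun i => eventually_all.2 fun j => hω i j (x i j)] with t ht
  ext i j
  rw [drivenOrbit_switchStep_apply, drivenOrbit_switchStep_apply]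
  exact (ht i j).1

theorem ae_eventually_backwardOrbit_eq (h : IsRandomSwitch μ ε a s q) (hε : 0 < ε) :
    ∀ᵐ ω ∂μ, ∀ x, ∀ᶠ t in atTop, backwardOrbit switchStep x t (fun k => (a k ω, s k ω))
      = limitSwitch fun k => (a k ω, s k ω) := by
  have hcouple := ae_all_iff.2 fun i => ae_all_iff.2 fun j =>
    (h.isStableQueueInput hε i j).ae_eventually_orbit_eq
  have hlimit := ae_all_iff.2 fun i => ae_all_iff.2 fun j =>
    (h.isStableQueueInput hε i j).ae_eventually_backwardQueue_eq
  filter_upwards [hcouple, hlimit] with ω hω hlim x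
  filter_upwards [eventually_all.2 fun i => eventually_all.2 fun j => hω i j (x i j),
    eventually_all.2 fun i => eventually_all.2 fun j => hlim i j] with t ht htlim
  ext i j
  rw [backwardOrbit_switchStep_apply, limitSwitch_apply]
  exact (ht i j).2.trans (htlim i j)

theorem isMarkovChain (h : IsRandomSwitch μ ε a s q) :
    IsMarkovChain μ q (queueTransition μ a s) :=
  h.isIID_input.isMarkovChain (F := switchStep) .of_discrete h.measurable_init
    h.indepFun_init_input h.queue_succ

theorem isPositiveRecurrentOn (h : IsRandomSwitch μ ε a s q) (hε : 0 < ε) :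
    IsPositiveRecurrentOn (queueTransition μ a s) (reachableFrom (queueTransition μ a s) 0) := by
  have hstat := h.isIID_input.isStationaryMeasure_limit_backwardOrbit (F := switchStep)
    .of_discrete measurable_limitSwitch
    ((h.ae_eventually_backwardOrbit_eq hε).mono fun _ hω => hω 0)
  exact isPositiveRecurrentOn_reachableFrom h.isMarkovChain.stochastic h.queueTransition_zero_pos
    h.zero_mem_reachableFrom hstat ((tsum_measure_eq
      (measurable_limitSwitch.comp h.isIID_input.measurable_process)).trans measure_univ)

theorem ae_eventually_mem_reachableFrom (h : IsRandomSwitch μ ε a s q) (hε : 0 < ε) :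
    ∀ᵐ ω ∂μ, ∀ᶠ t in atTop, q t ω ∈ reachableFrom (queueTransition μ a s) 0 := by
  filter_upwards [h.ae_eventually_drivenOrbit_eq hε,
    h.isIID_input.ae_drivenOrbit_mem_reachableFrom (F := switchStep) .of_discrete 0] with ω hω hmem
  filter_upwards [hω (q 0 ω)] with t ht
  have hq : q t ω = drivenOrbit switchStep (q 0 ω) (fun k => (a k ω, s k ω)) t :=
    congrFun (eq_drivenOrbit (W := fun k ω => (a k ω, s k ω)) h.queue_succ t) ω
  rw [hq, ht]
  exact hmem t

theorem tendstoInDistribution_limitSwitch (h : IsRandomSwitch μ ε a s q) (hε : 0 < ε) :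
    TendstoInDistribution q atTop (fun ω => limitSwitch fun k => (a k ω, s k ω))
      (fun _ => μ) μ := by
  refine h.isIID_input.tendstoInDistribution_of_backwardOrbit (F := switchStep) .of_discrete
    h.measurable_init h.indepFun_init_input h.queue_succ
    (measurable_limitSwitch.comp h.isIID_input.measurable_process).aemeasurable ?_
  filter_upwards [h.ae_eventually_backwardOrbit_eq hε] with ω hω
  exact tendsto_const_nhds.congr' ((hω (q 0 ω)).mono fun _ ht => ht.symm)

theorem integrable_limitSwitch_apply (h : IsRandomSwitch μ ε a s q) (hε : 0 < ε) (i j : Fin n) :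
    Integrable (fun ω => (limitSwitch (fun k => (a k ω, s k ω)) i j : ℝ)) μ := by
  simp only [limitSwitch_apply]
  exact (h.isStableQueueInput hε i j).integrable_limitQueue

theorem integral_limitSwitch_apply (h : IsRandomSwitch μ ε a s q) (hε : 0 < ε) (i j : Fin n) :
    ε * ∫ ω, (limitSwitch (fun k => (a k ω, s k ω)) i j : ℝ) ∂μ
      = n / 2 * variance (fun ω => (a 0 ω i j : ℝ)) μ
        + ((1 - 1 / n) / 2 + ε ^ 2 / (2 * n) - ε / 2) := by
  have hn : (n : ℝ) ≠ 0 := Nat.cast_ne_zero.2 i.pos.ne'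
  simp only [limitSwitch_apply]
  rw [(h.isStableQueueInput hε i j).integral_limitQueue, h.integral_netInput,
    h.integral_netInput_sq]
  field_simp
  ring

theorem integrable_totalQueue_limitSwitch (h : IsRandomSwitch μ ε a s q) (hε : 0 < ε) :
    Integrable (fun ω => totalQueue (limitSwitch fun k => (a k ω, s k ω))) μ :=
  integrable_finsetSum _ fun i _ => integrable_finsetSum _ fun j _ =>
    h.integrable_limitSwitch_apply hε i j

theorem integral_totalQueue_limitSwitch (h : IsRandomSwitch μ ε a s q) (hε : 0 < ε) :
    ε * ∫ ω, totalQueue (limitSwitch fun k => (a k ω, s k ω)) ∂μ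
      = n / 2 * ∑ i, ∑ j, variance (fun ω => (a 0 ω i j : ℝ)) μ
        + n * (n - 1) / 2 + n * ε ^ 2 / 2 - n ^ 2 * ε / 2 := by
  simp only [totalQueue]
  rw [integral_finsetSum _ fun i _ => integrable_finsetSum _ fun j _ =>
    h.integrable_limitSwitch_apply hε i j]
  simp only [integral_finsetSum _ fun j _ => h.integrable_limitSwitch_apply hε _ j,
    Finset.mul_sum, h.integral_limitSwitch_apply hε, Finset.sum_add_distrib, Finset.sum_const,
    Finset.card_univ, Fintype.card_fin, nsmul_eq_mul]
  rcases eq_or_ne (n : ℝ) 0 with hn | hn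
  · simp [hn]
  · field_simp
    ring

theorem exists_stationary (h : IsRandomSwitch μ ε a s q) (hε : 0 < ε) :
    ∃ π : ProbabilityMeasure (SwitchMat n),
      TendstoInDistribution q atTop id (fun _ => μ) (π : Measure (SwitchMat n)) ∧
      Integrable totalQueue (π : Measure (SwitchMat n)) ∧
      ε * ∫ x, totalQueue x ∂(π : Measure (SwitchMat n))
        = n / 2 * ∑ i, ∑ j, variance (fun ω => (a 0 ω i j : ℝ)) μ
          + n * (n - 1) / 2 + n * ε ^ 2 / 2 - n ^ 2 * ε / 2 := by
  have hlimit : AEMeasurable (fun ω => limitSwitch fun k => (a k ω, s k ω)) μ :=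
    (measurable_limitSwitch.comp h.isIID_input.measurable_process).aemeasurable
  have htotal : Measurable (totalQueue (n := n)) := .of_discrete
  refine ⟨⟨μ.map _, Measure.isProbabilityMeasure_map hlimit⟩,
    tendstoInDistribution_id_of_eq_map (h.tendstoInDistribution_limitSwitch hε) rfl, ?_, ?_⟩
  · exact (integrable_map_measure htotal.aestronglyMeasurable hlimit).2
      (h.integrable_totalQueue_limitSwitch hε)
  · rw [ProbabilityMeasure.coe_mk, integral_map hlimit htotal.aestronglyMeasurable,
      h.integral_totalQueue_limitSwitch hε]

end IsRandomSwitch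

section HeavyTraffic

variable {n : ℕ} {m : ℝ → ℝ}

theorem tendsto_mul_of_variance_tendsto {v : ℝ → Fin n → Fin n → ℝ} {V : Fin n → Fin n → ℝ}
    (hm : ∀ ε ∈ Set.Ioo (0 : ℝ) 1, ε * m ε = n / 2 * ∑ i, ∑ j, v ε i j
      + n * (n - 1) / 2 + n * ε ^ 2 / 2 - n ^ 2 * ε / 2)
    (hv : ∀ i j, Tendsto (fun ε => v ε i j) (𝓝[>] 0) (𝓝 (V i j))) :
    Tendsto (fun ε => ε * m ε) (𝓝[>] 0) (𝓝 (n / 2 * ∑ i, ∑ j, V i j + n * (n - 1) / 2)) := by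
  have hε : Tendsto (fun ε : ℝ => ε) (𝓝[>] 0) (𝓝 0) := nhdsWithin_le_nhds
  have hsum := tendsto_finsetSum Finset.univ fun i _ =>
    tendsto_finsetSum Finset.univ fun j _ => hv i j
  have hlim := (((hsum.const_mul ((n : ℝ) / 2)).add_const ((n : ℝ) * (n - 1) / 2)).add
    (((hε.pow 2).const_mul (n : ℝ)).div_const 2)).sub ((hε.const_mul ((n : ℝ) ^ 2)).div_const 2)
  simp only [zero_pow two_ne_zero, mul_zero, zero_div, add_zero, sub_zero] at hlim
  refine hlim.congr' ?_
  filter_upwards [Ioo_mem_nhdsGT one_pos] with ε hε01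
  exact (hm ε hε01).symm

theorem not_isMaxWeightLike {σ : Fin n → Fin n → ℝ} (hn : 2 ≤ n)
    (hm : Tendsto (fun ε => ε * m ε) (𝓝[>] 0)
      (𝓝 (n / 2 * frobeniusSq σ + n * (n - 1) / 2))) :
    ¬ IsMaxWeightLike m σ := by
  intro hmaxWeight
  have hn' : (2 : ℝ) ≤ n := by exact_mod_cast hn
  have hσ : 0 ≤ frobeniusSq σ :=
    Finset.sum_nonneg fun i _ => Finset.sum_nonneg fun j _ => sq_nonneg _
  have hlt : (1 - 1 / (2 * (n : ℝ))) * frobeniusSq σ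
      < n / 2 * frobeniusSq σ + n * (n - 1) / 2 :=
    calc (1 - 1 / (2 * (n : ℝ))) * frobeniusSq σ ≤ n / 2 * frobeniusSq σ := by
          have hpos : 0 ≤ 1 / (2 * (n : ℝ)) := by positivity
          gcongr
          linarith
      _ < n / 2 * frobeniusSq σ + n * (n - 1) / 2 := by
          have hpos : 0 < (n : ℝ) * (n - 1) := mul_pos (by linarith) (by linarith)
          linarith
  exact hlt.ne (tendsto_nhds_unique hmaxWeight hm)

theorem tendsto_bernoulli_variance (x : ℝ) :
    Tendsto (fun ε : ℝ => (1 - ε) / x * (1 - (1 - ε) / x)) (𝓝[>] 0) (𝓝 (1 / x * (1 - 1 / x))) := by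
  have hcont : Continuous fun ε : ℝ => (1 - ε) / x * (1 - (1 - ε) / x) := by fun_prop
  simpa using (hcont.tendsto 0).mono_left nhdsWithin_le_nhds

end HeavyTraffic

theorem mainTheorem7 (n : ℕ) (hn : 1 ≤ n)
    {Ω : ℝ → Type*} [∀ ε, MeasurableSpace (Ω ε)]
    (μ : ∀ ε, Measure (Ω ε)) [∀ ε, IsProbabilityMeasure (μ ε)]
    (a s q : ∀ ε, ℕ → Ω ε → SwitchMat n)
    (hswitch : ∀ ε ∈ Set.Ioo (0 : ℝ) 1, IsRandomSwitch (μ ε) ε (a ε) (s ε) (q ε)) :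
    -- the queue lengths form a positive recurrent Markov chain on the states reachable from `0`
    -- (for arbitrary initial queue lengths, from some time on)
    (∀ ε ∈ Set.Ioo (0 : ℝ) 1,
      IsMarkovChain (μ ε) (q ε) (queueTransition (μ ε) (a ε) (s ε)) ∧
      IsPositiveRecurrentOn (queueTransition (μ ε) (a ε) (s ε))
        (reachableFrom (queueTransition (μ ε) (a ε) (s ε)) 0) ∧
      ∀ᵐ ω ∂(μ ε), ∀ᶠ t in atTop,
        q ε t ω ∈ reachableFrom (queueTransition (μ ε) (a ε) (s ε)) 0) ∧
    -- the queue lengths converge in distribution, to the law `π ε`, which has a finite mean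
    ∃ π : ℝ → ProbabilityMeasure (SwitchMat n),
      (∀ ε ∈ Set.Ioo (0 : ℝ) 1,
        TendstoInDistribution (q ε) atTop id (fun _ => μ ε) (π ε : Measure (SwitchMat n)) ∧
        Integrable totalQueue (π ε : Measure (SwitchMat n))) ∧
      -- the heavy-traffic limit
      (∀ σ : Fin n → Fin n → ℝ,
        (∀ i j, Tendsto (fun ε => variance (fun ω => (a ε 0 ω i j : ℝ)) (μ ε)) (𝓝[>] 0)
          (𝓝 (σ i j ^ 2))) →
        Tendsto (fun ε => ε * ∫ x, totalQueue x ∂(π ε : Measure (SwitchMat n))) (𝓝[>] 0)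
          (𝓝 ((n : ℝ) / 2 * frobeniusSq σ + (n : ℝ) * ((n : ℝ) - 1) / 2)) ∧
        (2 ≤ n →
          ¬ IsMaxWeightLike (fun ε => ∫ x, totalQueue x ∂(π ε : Measure (SwitchMat n))) σ)) ∧
      -- the heavy-traffic limit for uniform Bernoulli traffic
      ((∀ ε ∈ Set.Ioo (0 : ℝ) 1, ∀ t i j, ∀ᵐ ω ∂(μ ε), a ε t ω i j = 0 ∨ a ε t ω i j = 1) →
        Tendsto (fun ε => ε * ∫ x, totalQueue x ∂(π ε : Measure (SwitchMat n))) (𝓝[>] 0)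
          (𝓝 ((n : ℝ) * ((n : ℝ) - 1)))) := by
  choose! π hlaw hint hmean using fun ε hε => (hswitch ε hε).exists_stationary hε.1
  refine ⟨fun ε hε => ⟨(hswitch ε hε).isMarkovChain, (hswitch ε hε).isPositiveRecurrentOn hε.1,
    (hswitch ε hε).ae_eventually_mem_reachableFrom hε.1⟩, π,
    fun ε hε => ⟨hlaw ε hε, hint ε hε⟩, fun σ hσ => ?_, fun hbernoulli => ?_⟩
  · have hlim := tendsto_mul_of_variance_tendsto hmean hσ
    exact ⟨hlim, fun hn2 => not_isMaxWeightLike hn2 hlim⟩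
  · have hvar (i j : Fin n) : Tendsto (fun ε => variance (fun ω => (a ε 0 ω i j : ℝ)) (μ ε))
        (𝓝[>] 0) (𝓝 (1 / n * (1 - 1 / n))) := by
      refine (tendsto_bernoulli_variance n).congr' ?_
      filter_upwards [Ioo_mem_nhdsGT one_pos] with ε hε
      exact ((hswitch ε hε).variance_arrival_of_ae_eq_zero_or_one (hbernoulli ε hε 0 i j)).symm
    convert tendsto_mul_of_variance_tendsto hmean hvar using 2
    simp only [Finset.sum_const, Finset.card_univ, Fintype.card_fin, nsmul_eq_mul]
    field_simp
    ring
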